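/- **Setting.** Let $N$ be a ground set of $n$ elements, $1\le k\le n$, $m\ge 2$, and let $f_1,\dots,f_m:2^N\to\mathbb R_{\ge 0}$ be monotone submodular with targets $V_1,\dots,V_m>0$. Assume some $S^*\subseteq N$ with $|S^*|\le k$ satisfies $f_i(S^*)\ge V_i$ for all $i$. A set $S$ is a feasible $\rho$-approximate set if $|S|\le k$ and $f_i(S)\ge \rho V_i$ for all $i$. The functions are accessed by queries; a query names a set $S$ and returns $(f_1(S),\dots,f_m(S))$. Let $0<\delta<1-1/e$ and $\varepsilon=\min\{\frac1{8\ln m},\sqrt[4]{m/k}\}$. **Algorithm.** Every $f_i$ is replaced by $\min\{f_i,V_i\}$. *Stage 1:* start with $S_1=\emptyset$ and scan the elements once in a fixed order, adding $e$ to $S_1$ if $f_i(S_1\cup\{e\})-f_i(S_1)\ge \varepsilon^3V_i$ for some $i$. Put $k_1=k-|S_1|$. *Stage 2 (multiplicative weight updates):* let $\eta=\delta/2$, $\alpha=1-1/e-\eta$, $T=\lceil 2\ln m/\eta^2\rceil$. For the $i$ with $f_i(S_1)<V_i$ put $\tilde f_i(X)=\frac{f_i(S_1\cup X)-f_i(S_1)}{V_i-f_i(S_1)}$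 and $\lambda_i=1/m$; the other $i$ are dropped. For $t=1,\dots,T$ compute, with the descending-thresholds greedy algorithm (thresholds $d,(1-\eta)d,(1-\eta)^2d,\dots$ down to $\frac{\eta}{n}d$, where $d$ is the maximum value of a singleton) on ground set $N\setminus S_1$, a set $X^t$ for the single objective $\sum_i\lambda_i\tilde f_i$, filled up to $k_1$ elements; then replace each $\lambda_i$ by $\lambda_i\,(1-\eta(\tilde f_i(X^t)-\alpha))$. *Stage 3:* swap rounding of $\frac1T\sum_t \mathbf 1_{X^t}$, as a convex combination of the $T$ sets, gives a random set $S_2$. The output is $S_1\cup S_2$. **Theorem.** There are absolute constants $C,p>0$ such that: 1. The algorithm makes at most $C\,\frac{n}{\delta^3}\,\log m\,\log\frac n\delta$ queries (whatever the functions $f_i$ and targets $V_i$ are). 2. If $\frac{m}{k\varepsilon^3}\le\frac13$, then with probability at least $p$ it outputs a feasible $\left[(1-\varepsilon)\left(1-\frac1e\right)^2\left(1-\frac{m}{k\varepsilon^3}\right)-\delta\right]$-approximate set. 3. Let $m=m(k)\ge 2$ with $m(k)=o(k/\log^3k)$ as $k\to\infty$. Then there are $r(k)\to(1-1/e)^2$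 such that for all sufficiently large $k$, for every such instance with cardinality bound $k$ and $m(k)$ objectives and for every $\delta\in(0,1-1/e)$, the algorithm outputs a feasible $(r(k)-\delta)$-approximate set with probability at least $p$. -/

import Mathlib

open Filter Asymptotics Topology

noncomputable section

/-! ### Randomized algorithms with a query oracle -/

/-- A randomized algorithm that returns an `R` and may, adaptively, ask an oracle questions of
type `Q` with answers of type `A`. It is either finished (`ret`), or asks one question and goes on
depending on the answer (`query`), or draws a uniformly random element of `{0, …, t}` and goes on
depending on it (`draw`). -/
inductive QueryAlg (Q A R : Type) : Type
  | ret (r : R) : QueryAlg Q A R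
  | query (q : Q) (next : A → QueryAlg Q A R) : QueryAlg Q A R
  | draw (t : ℕ) (next : Fin (t + 1) → QueryAlg Q A R) : QueryAlg Q A R

namespace QueryAlg

variable {Q A R R' : Type}

/-- Sequential composition. -/
def bind : QueryAlg Q A R → (R → QueryAlg Q A R') → QueryAlg Q A R'
  | ret r, F => F r
  | query q next, F => query q (fun a => (next a).bind F)
  | draw t next, F => draw t (fun u => (next u).bind F)

instance : Monad (QueryAlg Q A) where
  pure := QueryAlg.ret
  bind := QueryAlg.bind

/-- The distribution of the result when the oracle is `O`. -/
def output (O : Q → A) : QueryAlg Q A R → PMF R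
  | ret r => PMF.pure r
  | query q next => (next (O q)).output O
  | draw t next => (PMF.uniformOfFintype (Fin (t + 1))).bind (fun u => (next u).output O)

/-- The number of questions asked when the oracle is `O`, in the worst case over the random
draws. -/
def queries (O : Q → A) : QueryAlg Q A R → ℕ
  | ret _ => 0
  | query q next => (next (O q)).queries O + 1
  | draw _ next => Finset.univ.sup (fun u => (next u).queries O)

end QueryAlg

/-! ### The problem -/

/-- Submodularity of a set function. -/
def IsSubmodular {n : ℕ} (f : Finset (Fin n) → ℝ) : Prop :=
  ∀ A B, f (A ∪ B) + f (A ∩ B) ≤ f A + f B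

/-- `f` consists of nonnegative monotone submodular functions, the targets `V i` are positive, and
some set with at most `k` elements meets all the targets. -/
structure IsFeasibleInstance {n m : ℕ} (f : Fin m → Finset (Fin n) → ℝ) (V : Fin m → ℝ)
    (k : ℕ) : Prop where
  nonneg : ∀ i S, 0 ≤ f i S
  monotone : ∀ i, Monotone (f i)
  submodular : ∀ i, IsSubmodular (f i)
  target_pos : ∀ i, 0 < V i
  feasible : ∃ S : Finset (Fin n), S.card ≤ k ∧ ∀ i, V i ≤ f i S

/-- `S` has at most `k` elements and meets all the targets up to the factor `ρ`. -/
def IsApproxSolution {n m : ℕ} (f : Fin m → Finset (Fin n) → ℝ) (V : Fin m → ℝ) (k : ℕ) (ρ : ℝ)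
    (S : Finset (Fin n)) : Prop :=
  S.card ≤ k ∧ ∀ i, ρ * V i ≤ f i S

/-- Algorithms that access `m` set functions on `{0, …, n - 1}`: one query names a set and is
answered by the values of all `m` functions at that set. -/
abbrev SetAlg (n m : ℕ) (R : Type) : Type := QueryAlg (Finset (Fin n)) (Fin m → ℝ) R

/-- The oracle that belongs to `f`. -/
def valueOracle {n m : ℕ} (f : Fin m → Finset (Fin n) → ℝ) : Finset (Fin n) → Fin m → ℝ :=
  fun S i => f i S

/-- Query the values at `S` of the capped functions `min (f i) (V i)`. -/
def cappedValues {n m : ℕ} (V : Fin m → ℝ) (S : Finset (Fin n)) : SetAlg n m (Fin m → ℝ) :=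
  QueryAlg.query S (fun y => QueryAlg.ret (fun i => min (y i) (V i)))

/-! ### Stage 1: elements with large marginal value -/

/-- One pass over a list of elements; `e` is added to the current set `S` if its marginal value is
at least `ε ^ 3 * V i` for some `i`. Here `y` holds the (capped) values at `S`. -/
def stageOne {n m : ℕ} (V : Fin m → ℝ) (ε : ℝ) :
    List (Fin n) → Finset (Fin n) → (Fin m → ℝ) → SetAlg n m (Finset (Fin n) × (Fin m → ℝ))
  | [], S, y => pure (S, y)
  | e :: L, S, y => do
      let z ← cappedValues V (insert e S)
      if ∃ i, ε ^ 3 * V i ≤ z i - y i then stageOne V ε L (insert e S) z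
      else stageOne V ε L S y

/-! ### The thresholding algorithm for a single objective -/

/-- One pass of the thresholding algorithm over a list of elements: as long as the current set `X`
has fewer than `k` elements, `e` is added if its marginal value is at least `w`. The procedure `g`
evaluates the objective, and `x` is its value at `X`. -/
def thresholdPass {n m : ℕ} (g : Finset (Fin n) → SetAlg n m ℝ) (k : ℕ) (w : ℝ) :
    List (Fin n) → Finset (Fin n) → ℝ → SetAlg n m (Finset (Fin n) × ℝ)
  | [], X, x => pure (X, x)
  | e :: L, X, x =>
      if X.card < k ∧ e ∉ X then do
        let z ← g (insert e X)
        if w ≤ z - x then thresholdPass g k w L (insert e X) z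
        else thresholdPass g k w L X x
      else thresholdPass g k w L X x

/-- The passes of the thresholding algorithm for a list of thresholds. -/
def thresholdPasses {n m : ℕ} (g : Finset (Fin n) → SetAlg n m ℝ) (k : ℕ) (G : List (Fin n)) :
    List ℝ → Finset (Fin n) → ℝ → SetAlg n m (Finset (Fin n))
  | [], X, _ => pure X
  | w :: W, X, x => do
      let r ← thresholdPass g k w G X x
      thresholdPasses g k G W r.1 r.2

/-- The maximum of `d` and the values of the singletons `{e}`, for `e` in a list. -/
def maxSingleton {n m : ℕ} (g : Finset (Fin n) → SetAlg n m ℝ) :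
    List (Fin n) → ℝ → SetAlg n m ℝ
  | [], d => pure d
  | e :: L, d => do
      let z ← g {e}
      maxSingleton g L (max d z)

/-- Fill `X` up to `k` elements with elements of `G`, in the order of the list. -/
def padTo {n : ℕ} (k : ℕ) (G : List (Fin n)) (X : Finset (Fin n)) : Finset (Fin n) :=
  X ∪ ((G.filter (fun e => e ∉ X)).take (k - X.card)).toFinset

/-- The thresholding algorithm with accuracy `η` for an objective with value `0` at the empty set,
ground set `G` and cardinality bound `k`. The thresholds are `d, (1 - η) d, (1 - η)² d, …`, as long
as they are at least `(η / n) d`, where `d` is the maximum value of a singleton. The result is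
filled up to `k` elements. -/
def thresholdGreedy {n m : ℕ} (g : Finset (Fin n) → SetAlg n m ℝ) (k : ℕ) (G : List (Fin n))
    (η : ℝ) : SetAlg n m (Finset (Fin n)) := do
  let d ← maxSingleton g G 0
  let X ← thresholdPasses g k G
    ((List.range (⌊Real.log (n / η) / Real.log (1 / (1 - η))⌋₊ + 1)).map
      (fun j => (1 - η) ^ j * d)) ∅ 0
  pure (padTo k G X)

/-! ### Stage 2: multiplicative weight updates -/

/-- Query the values at `X` of the normalized marginals
`(f i (S₁ ∪ X) - f i S₁) / (V i - f i S₁)` of the capped functions; `y` holds the capped values at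
`S₁`. (An objective with `y i = V i` gets the value `0`; it always has weight `0` below.) -/
def normalizedMarginals {n m : ℕ} (V : Fin m → ℝ) (S₁ : Finset (Fin n)) (y : Fin m → ℝ)
    (X : Finset (Fin n)) : SetAlg n m (Fin m → ℝ) := do
  let z ← cappedValues V (S₁ ∪ X)
  pure (fun i => (z i - y i) / (V i - y i))

/-- `T` rounds of multiplicative weight updates with step `η` and weights `lam`: each round
computes a set `X` with the thresholding algorithm (accuracy `η`, guarantee `1 - 1 / e - η`) for the
weighted sum of the normalized marginals, and multiplies the weight of `i` by
`1 - η * (normalized marginal of i at X - (1 - 1 / e - η))`. The result is the list of the `X`. -/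
def mwuRounds {n m : ℕ} (V : Fin m → ℝ) (S₁ : Finset (Fin n)) (y : Fin m → ℝ) (k₁ : ℕ) (η : ℝ) :
    ℕ → (Fin m → ℝ) → SetAlg n m (List (Finset (Fin n)))
  | 0, _ => pure []
  | T + 1, lam => do
      let X ← thresholdGreedy
        (fun X => do
          let v ← normalizedMarginals V S₁ y X
          pure (∑ i, lam i * v i))
        k₁ ((List.finRange n).filter (fun e => e ∉ S₁)) η
      let v ← normalizedMarginals V S₁ y X
      let Xs ← mwuRounds V S₁ y k₁ η T
        (fun i => lam i * (1 - η * (v i - (1 - 1 / Real.exp 1 - η))))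
      pure (X :: Xs)

/-- Stage 2: `⌈2 log m / η²⌉` rounds that start with the weight `1 / m` for every objective that
has not reached its target at `S₁` (the others are dropped). -/
def stageTwo {n m : ℕ} (V : Fin m → ℝ) (S₁ : Finset (Fin n)) (y : Fin m → ℝ) (k₁ : ℕ) (η : ℝ) :
    SetAlg n m (List (Finset (Fin n))) :=
  mwuRounds V S₁ y k₁ η ⌈2 * Real.log m / η ^ 2⌉₊ (fun i => if y i < V i then 1 / (m : ℝ) else 0)

/-! ### Stage 3: swap rounding -/

/-- Merge the sets `B` and `B'` with weights `t` and `1`. For each pair `(a, b)` of the list, with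
`a` in `B` but not `B'` and `b` in `B'` but not `B`: with probability `t / (t + 1)` replace `b` by
`a` in `B'`, and otherwise replace `a` by `b` in `B`. At the end the two sets agree. -/
def mergePairs {n m : ℕ} (t : ℕ) :
    List (Fin n × Fin n) → Finset (Fin n) → Finset (Fin n) → SetAlg n m (Finset (Fin n))
  | [], B, _ => pure B
  | (a, b) :: L, B, B' =>
      QueryAlg.draw t (fun u =>
        if u = 0 then mergePairs t L (insert b (B.erase a)) B'
        else mergePairs t L B (insert a (B'.erase b)))

/-- Merge two sets of the same size, with weights `t` and `1`. -/
def mergeBases {n m : ℕ} (t : ℕ) (B B' : Finset (Fin n)) : SetAlg n m (Finset (Fin n)) :=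
  mergePairs t (((B \ B').sort (· ≤ ·)).zip ((B' \ B).sort (· ≤ ·))) B B'

/-- Merge `C`, which stands for `t` sets of weight `1` already merged, with further sets of
weight `1`, one after the other. -/
def swapMerge {n m : ℕ} : ℕ → Finset (Fin n) → List (Finset (Fin n)) → SetAlg n m (Finset (Fin n))
  | _, C, [] => pure C
  | t, C, B :: L => do
      let C' ← mergeBases t C B
      swapMerge (t + 1) C' L

/-- Swap rounding of the average of the indicator vectors of a list of sets of the same size. -/
def swapRound {n m : ℕ} : List (Finset (Fin n)) → SetAlg n m (Finset (Fin n))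
  | [] => pure ∅
  | X :: L => swapMerge 1 X L

/-! ### The algorithm -/

/-- The whole algorithm. The output is the union of the set of stage 1 and of the set obtained by
swap rounding of the point found in stage 2; both accuracy parameters of stage 2 are `δ / 2`. -/
def mwuAlgorithm (n m k : ℕ) (V : Fin m → ℝ) (ε δ : ℝ) : SetAlg n m (Finset (Fin n)) := do
  let y₀ ← cappedValues V ∅
  let r ← stageOne V ε (List.finRange n) ∅ y₀
  let Xs ← stageTwo V r.1 r.2 (k - r.1.card) (δ / 2)
  let S₂ ← swapRound Xs
  pure (r.1 ∪ S₂)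

/-- The parameter `ε = min (1 / (8 log m)) ((m / k) ^ (1 / 4))`. -/
def epsParam (m k : ℕ) : ℝ :=
  min (1 / (8 * Real.log m)) (((m : ℝ) / k) ^ (1 / 4 : ℝ))

/-- The factor `(1 - ε) (1 - 1 / e)² (1 - m / (k ε³))`. -/
def guarantee (m k : ℕ) : ℝ :=
  (1 - epsParam m k) * (1 - 1 / Real.exp 1) ^ 2 * (1 - m / (k * epsParam m k ^ 3))

/-- The probability that the algorithm, run on `f`, outputs a set with at most `k` elements that
meets all the targets up to the factor `ρ`. -/
def successProb {n m : ℕ} (k : ℕ) (V : Fin m → ℝ) (δ : ℝ) (f : Fin m → Finset (Fin n) → ℝ)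
    (ρ : ℝ) : ENNReal :=
  ((mwuAlgorithm n m k V (epsParam m k) δ).output (valueOracle f)).toOuterMeasure
    {S | IsApproxSolution f V k ρ S}

end

namespace QueryAlg

variable {Q A R R' : Type}

/-- Every result that is possible when the oracle is `O` satisfies `P`. -/
def Always (O : Q → A) : QueryAlg Q A R → (R → Prop) → Prop
  | ret r, P => P r
  | query q next, P => (next (O q)).Always O P
  | draw _ next, P => ∀ u, (next u).Always O P

/-- The expectation of `h` at the result when the oracle is `O`. -/
noncomputable def expect (O : Q → A) : QueryAlg Q A R → (R → ℝ) → ℝ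
  | ret r, h => h r
  | query q next, h => (next (O q)).expect O h
  | draw t next, h => (∑ u, (next u).expect O h) / (t + 1)

variable {O : Q → A}

theorem always_bind {a : QueryAlg Q A R} {F : R → QueryAlg Q A R'} {P : R' → Prop} :
    (a >>= F).Always O P ↔ a.Always O (fun r => (F r).Always O P) := by
  change (a.bind F).Always O P ↔ _
  induction a with
  | ret r => exact Iff.rfl
  | query q next ih => exact ih _
  | draw t next ih => exact forall_congr' fun u => ih u

theorem Always.mono {a : QueryAlg Q A R} {P P' : R → Prop} (h : a.Always O P)
    (hP : ∀ r, P r → P' r) : a.Always O P' := by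
  induction a with
  | ret r => exact hP _ h
  | query q next ih => exact ih _ h
  | draw t next ih => exact fun u => ih u (h u)

theorem always_of_forall (a : QueryAlg Q A R) {P : R → Prop} (hP : ∀ r, P r) :
    a.Always O P := by
  induction a with
  | ret r => exact hP _
  | query q next ih => exact ih _
  | draw t next ih => exact fun u => ih u

theorem expect_pure {r : R} {h : R → ℝ} : (pure r : QueryAlg Q A R).expect O h = h r := rfl

theorem expect_bind {a : QueryAlg Q A R} {F : R → QueryAlg Q A R'} {h : R' → ℝ} :
    (a >>= F).expect O h = a.expect O (fun r => (F r).expect O h) := by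
  change (a.bind F).expect O h = _
  induction a with
  | ret r => rfl
  | query q next ih => exact ih _
  | draw t next ih =>
    change (∑ u, ((next u).bind F).expect O h) / ((t : ℝ) + 1) = _
    simp only [ih]; rfl

theorem Always.expect_le_expect {a : QueryAlg Q A R} {P : R → Prop} (ha : a.Always O P)
    {h h' : R → ℝ} (hh : ∀ r, P r → h r ≤ h' r) : a.expect O h ≤ a.expect O h' := by
  induction a with
  | ret r => exact hh _ ha
  | query q next ih => exact ih _ ha
  | draw t next ih =>
    have := Finset.sum_le_sum fun u (_ : u ∈ Finset.univ) => ih u (ha u)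
    simp only [expect]
    gcongr

theorem expect_const (a : QueryAlg Q A R) (c : ℝ) : a.expect O (fun _ => c) = c := by
  induction a with
  | ret r => rfl
  | query q next ih => exact ih _
  | draw t next ih =>
    simp only [expect, ih, Finset.sum_const, Finset.card_univ, Fintype.card_fin, nsmul_eq_mul]
    push_cast
    field_simp

theorem Always.le_expect {a : QueryAlg Q A R} {P : R → Prop} (ha : a.Always O P)
    {h : R → ℝ} {c : ℝ} (hh : ∀ r, P r → c ≤ h r) : c ≤ a.expect O h :=
  (a.expect_const c).symm.le.trans (ha.expect_le_expect hh)

theorem expect_add (a : QueryAlg Q A R) (h h' : R → ℝ) :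
    a.expect O (fun r => h r + h' r) = a.expect O h + a.expect O h' := by
  induction a with
  | ret r => rfl
  | query q next ih => exact ih _
  | draw t next ih => simp only [expect, ih, Finset.sum_add_distrib, add_div]

theorem expect_const_mul (a : QueryAlg Q A R) (c : ℝ) (h : R → ℝ) :
    a.expect O (fun r => c * h r) = c * a.expect O h := by
  induction a with
  | ret r => rfl
  | query q next ih => exact ih _
  | draw t next ih => simp only [expect, ih, ← Finset.mul_sum, mul_div_assoc]

theorem expect_sum {ι : Type} (s : Finset ι) (a : QueryAlg Q A R) (h : ι → R → ℝ) :
    a.expect O (fun r => ∑ i ∈ s, h i r) = ∑ i ∈ s, a.expect O (h i) := by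
  classical
  induction s using Finset.induction_on with
  | empty => simpa using a.expect_const 0
  | insert i s hi ih => simp only [Finset.sum_insert hi, expect_add, ih]

theorem output_toOuterMeasure (a : QueryAlg Q A R) (s : Set R) :
    (a.output O).toOuterMeasure s = ENNReal.ofReal (a.expect O (s.indicator 1)) := by
  classical
  induction a with
  | ret r =>
    simp only [output, expect, PMF.toOuterMeasure_pure_apply, Set.indicator_apply]
    split_ifs <;> simp
  | query q next ih => exact ih _
  | draw t next ih =>
    have h0 : ∀ u, 0 ≤ (next u).expect O (s.indicator 1) := fun u =>
      Always.le_expect ((next u).always_of_forall fun _ => trivial)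
        fun r _ => Set.indicator_nonneg (by simp) r
    simp only [output, expect, PMF.toOuterMeasure_bind_apply, tsum_fintype, ih,
      PMF.uniformOfFintype_apply, Fintype.card_fin]
    rw [← Finset.mul_sum, ← ENNReal.ofReal_sum_of_nonneg fun u _ => h0 u, div_eq_inv_mul,
      ENNReal.ofReal_mul (by positivity), ENNReal.ofReal_inv_of_pos (by positivity)]
    congr 2
    norm_cast

theorem queries_bind_le {a : QueryAlg Q A R} {F : R → QueryAlg Q A R'} {c d : ℕ}
    (ha : a.queries O ≤ c) (hF : ∀ r, (F r).queries O ≤ d) : (a >>= F).queries O ≤ c + d := by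
  change (a.bind F).queries O ≤ c + d
  induction a generalizing c with
  | ret r => exact (hF r).trans (Nat.le_add_left _ _)
  | query q next ih =>
    have ha' : (next (O q)).queries O + 1 ≤ c := ha
    have := ih (O q) le_rfl
    change ((next (O q)).bind F).queries O + 1 ≤ c + d
    omega
  | draw t next ih =>
    have ha' : Finset.univ.sup (fun u => (next u).queries O) ≤ c := ha
    rw [Finset.sup_le_iff] at ha'
    exact Finset.sup_le fun u hu => ih u (ha' u hu)

theorem queries_pure (r : R) : (pure r : QueryAlg Q A R).queries O = 0 := rfl

end QueryAlg

/-! ### Monotone submodular functions -/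

theorem IsSubmodular.insert_sub_le {n : ℕ} {f : Finset (Fin n) → ℝ} (hs : IsSubmodular f)
    (hm : Monotone f) {A B : Finset (Fin n)} (h : A ⊆ B) (e : Fin n) :
    f (insert e B) - f B ≤ f (insert e A) - f A := by
  by_cases he : e ∈ B
  · have := hm (Finset.subset_insert e A)
    rw [Finset.insert_eq_self.2 he]
    linarith
  · have h1 := hs (insert e A) B
    rw [Finset.insert_union, Finset.union_eq_right.2 h, Finset.insert_inter_of_notMem he,
      Finset.inter_eq_left.2 h] at h1
    linarith

theorem IsSubmodular.union_le {n : ℕ} {f : Finset (Fin n) → ℝ} (hs : IsSubmodular f)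
    (hm : Monotone f) (X S : Finset (Fin n)) :
    f (X ∪ S) ≤ f X + ∑ e ∈ S, (f (insert e X) - f X) := by
  induction S using Finset.induction_on with
  | empty => simp
  | insert e S he ih =>
    have := hs.insert_sub_le hm (Finset.subset_union_left (s₁ := X) (s₂ := S)) e
    rw [Finset.sum_insert he, Finset.union_insert]
    linarith

theorem IsSubmodular.min_const {n : ℕ} {f : Finset (Fin n) → ℝ} (hs : IsSubmodular f)
    (hm : Monotone f) (c : ℝ) : IsSubmodular (fun S => min (f S) c) := by
  intro A B
  have h1 := hs A B
  have h2 := hm (Finset.subset_union_left (s₁ := A) (s₂ := B))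
  have h3 := hm (Finset.subset_union_right (s₁ := A) (s₂ := B))
  have h4 := hm (Finset.inter_subset_left (s₁ := A) (s₂ := B))
  have h5 := hm (Finset.inter_subset_right (s₁ := A) (s₂ := B))
  simp only [min_def] at *
  split_ifs <;> linarith

theorem IsSubmodular.neg_exp {n : ℕ} {f : Finset (Fin n) → ℝ} (hs : IsSubmodular f)
    (hm : Monotone f) {c : ℝ} (hc : 0 ≤ c) :
    IsSubmodular (fun S => -Real.exp (-c * f S)) := by
  intro A B
  have h1 := hs A B
  have h4 := hm (Finset.inter_subset_left (s₁ := A) (s₂ := B))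
  have h5 := hm (Finset.inter_subset_right (s₁ := A) (s₂ := B))
  set a := Real.exp (-c * (f A - f (A ∩ B)))
  set b := Real.exp (-c * (f B - f (A ∩ B)))
  set p := Real.exp (-c * f (A ∩ B)) with hp
  have ha : a ≤ 1 := Real.exp_le_one_iff.2 (by nlinarith)
  have hb : b ≤ 1 := Real.exp_le_one_iff.2 (by nlinarith)
  have h6 : Real.exp (-c * f A) = p * a := by rw [← Real.exp_add]; ring_nf
  have h7 : Real.exp (-c * f B) = p * b := by rw [← Real.exp_add]; ring_nf
  have h8 : p * a * b ≤ Real.exp (-c * f (A ∪ B)) := by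
    rw [← Real.exp_add, ← Real.exp_add]
    exact Real.exp_le_exp.2 (by nlinarith)
  have hp0 : 0 < p := Real.exp_pos _
  have : 0 ≤ p * ((1 - a) * (1 - b)) :=
    mul_nonneg hp0.le (mul_nonneg (by linarith) (by linarith))
  simp only [h6, h7]
  nlinarith

theorem IsSubmodular.comp_union {n : ℕ} {f : Finset (Fin n) → ℝ} (hs : IsSubmodular f)
    (S : Finset (Fin n)) : IsSubmodular (fun X => f (S ∪ X)) := by
  intro A B
  have := hs (S ∪ A) (S ∪ B)
  rwa [← Finset.union_union_distrib_left, ← Finset.union_inter_distrib_left] at this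

theorem IsSubmodular.sub_div {n : ℕ} {f : Finset (Fin n) → ℝ} (hs : IsSubmodular f)
    (c : ℝ) {d : ℝ} (hd : 0 ≤ d) : IsSubmodular (fun X => (f X - c) / d) := by
  intro A B
  have := hs A B
  simp only [← add_div]
  exact div_le_div_of_nonneg_right (by linarith) hd

theorem IsSubmodular.sum_mul {n m : ℕ} {f : Fin m → Finset (Fin n) → ℝ}
    (hs : ∀ i, IsSubmodular (f i)) {c : Fin m → ℝ} (hc : ∀ i, 0 ≤ c i) :
    IsSubmodular (fun X => ∑ i, c i * f i X) := by
  intro A B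
  simp only [← Finset.sum_add_distrib, ← mul_add]
  exact Finset.sum_le_sum fun i _ => mul_le_mul_of_nonneg_left (hs i A B) (hc i)

/-! ### The multilinear extension -/

/-- The expectation of `f (S ∪ R)`, when `R` contains each element `e` of the list `L`
independently with probability `x e`. -/
def mlExt {n : ℕ} (f : Finset (Fin n) → ℝ) (x : Fin n → ℝ) :
    List (Fin n) → Finset (Fin n) → ℝ
  | [], S => f S
  | e :: L, S => x e * mlExt f x L (insert e S) + (1 - x e) * mlExt f x L S

section mlExt

variable {n : ℕ} {f : Finset (Fin n) → ℝ} {x : Fin n → ℝ}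

theorem mlExt_perm {L L' : List (Fin n)} (h : L.Perm L') (S : Finset (Fin n)) :
    mlExt f x L S = mlExt f x L' S := by
  induction h generalizing S with
  | nil => rfl
  | cons e _ ih => simp only [mlExt, ih]
  | swap a b L => simp only [mlExt, Finset.insert_comm a b]; ring
  | trans _ _ ih₁ ih₂ => rw [ih₁, ih₂]

theorem mlExt_congr {x' : Fin n → ℝ} {L : List (Fin n)} (h : ∀ e ∈ L, x e = x' e)
    (S : Finset (Fin n)) : mlExt f x L S = mlExt f x' L S := by
  induction L generalizing S with
  | nil => rfl
  | cons e L ih =>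
    have := ih fun e he => h e (List.mem_cons_of_mem _ he)
    simp only [mlExt, this, h e List.mem_cons_self]

theorem mlExt_neg (L : List (Fin n)) (S : Finset (Fin n)) :
    mlExt (fun S => -f S) x L S = -mlExt f x L S := by
  induction L generalizing S with
  | nil => rfl
  | cons e L ih => simp only [mlExt, ih]; ring

theorem mlExt_indicator (C : Finset (Fin n)) (L : List (Fin n)) (S : Finset (Fin n)) :
    mlExt f (fun e => if e ∈ C then 1 else 0) L S = f (S ∪ C ∩ L.toFinset) := by
  induction L generalizing S with
  | nil => simp [mlExt]
  | cons e L ih =>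
    simp only [mlExt, ih, List.toFinset_cons]
    split_ifs with h
    · rw [Finset.inter_insert_of_mem h, Finset.union_insert, Finset.insert_union]; ring
    · rw [Finset.inter_insert_of_notMem h]; ring

theorem mlExt_zero (L : List (Fin n)) (S : Finset (Fin n)) :
    mlExt f (fun _ => 0) L S = f S := by
  induction L generalizing S with
  | nil => rfl
  | cons e L ih => simp [mlExt, ih]

theorem mlExt_monotone (hm : Monotone f) (h0 : ∀ e, 0 ≤ x e) (h1 : ∀ e, x e ≤ 1)
    (L : List (Fin n)) : Monotone (mlExt f x L) := by
  induction L with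
  | nil => exact hm
  | cons e L ih =>
    intro A B h
    exact add_le_add (mul_le_mul_of_nonneg_left (ih (Finset.insert_subset_insert e h)) (h0 e))
      (mul_le_mul_of_nonneg_left (ih h) (by linarith [h1 e]))

theorem mlExt_isSubmodular (hs : IsSubmodular f) {L : List (Fin n)} (h0 : ∀ e ∈ L, 0 ≤ x e)
    (h1 : ∀ e ∈ L, x e ≤ 1) : IsSubmodular (mlExt f x L) := by
  induction L with
  | nil => exact hs
  | cons e L ih =>
    intro A B
    have ih := ih (fun e he => h0 e (List.mem_cons_of_mem _ he))
      (fun e he => h1 e (List.mem_cons_of_mem _ he))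
    have h2 := ih (insert e A) (insert e B)
    rw [← Finset.insert_union_distrib, ← Finset.insert_inter_distrib] at h2
    have h3 := ih A B
    have h4 := mul_le_mul_of_nonneg_left h2 (h0 e List.mem_cons_self)
    have h5 := mul_le_mul_of_nonneg_left h3 (sub_nonneg.2 (h1 e List.mem_cons_self))
    simp only [mlExt]
    linarith

theorem le_mlExt (hm : Monotone f) (h0 : ∀ e, 0 ≤ x e) (h1 : ∀ e, x e ≤ 1)
    (L : List (Fin n)) (S : Finset (Fin n)) : f S ≤ mlExt f x L S := by
  induction L generalizing S with
  | nil => exact le_rfl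
  | cons e L ih =>
    have h2 := mul_le_mul_of_nonneg_left
      ((hm (Finset.subset_insert e S)).trans (ih (insert e S))) (h0 e)
    have h3 := mul_le_mul_of_nonneg_left (ih S) (sub_nonneg.2 (h1 e))
    simp only [mlExt]
    linarith

theorem mlExt_insert_sub_le (hs : IsSubmodular f) (hm : Monotone f) (h0 : ∀ e, 0 ≤ x e)
    (h1 : ∀ e, x e ≤ 1) (L : List (Fin n)) (a : Fin n) (S : Finset (Fin n)) :
    mlExt f x L (insert a S) - mlExt f x L S ≤ f (insert a S) - f S := by
  induction L generalizing S with
  | nil => exact le_rfl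
  | cons e L ih =>
    have h2 := mul_le_mul_of_nonneg_left
      ((ih (insert e S)).trans (hs.insert_sub_le hm (Finset.subset_insert e S) a)) (h0 e)
    have h3 := mul_le_mul_of_nonneg_left (ih S) (sub_nonneg.2 (h1 e))
    simp only [mlExt, Finset.insert_comm e a]
    linarith

/-- Moving a centered random amount of mass between two coordinates does not decrease the expected
multilinear extension of a submodular function. -/
theorem mlExt_le_exchange (hs : IsSubmodular f) {L : List (Fin n)} (hL : L.Nodup) {a b : Fin n}
    (hab : a ≠ b) (ha : a ∈ L) (hb : b ∈ L) (h0 : ∀ e, 0 ≤ x e) (h1 : ∀ e, x e ≤ 1)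
    {x₁ x₂ : Fin n → ℝ} {s t : ℝ} (ht : 0 ≤ t)
    (ha₁ : x₁ a = x a - t * s) (hb₁ : x₁ b = x b + t * s)
    (ha₂ : x₂ a = x a + s) (hb₂ : x₂ b = x b - s)
    (hx₁ : ∀ e, e ≠ a → e ≠ b → x₁ e = x e) (hx₂ : ∀ e, e ≠ a → e ≠ b → x₂ e = x e)
    (S : Finset (Fin n)) :
    mlExt f x L S ≤ (mlExt f x₁ L S + t * mlExt f x₂ L S) / (t + 1) := by
  have hp : L.Perm (a :: b :: (L.erase a).erase b) :=
    (List.perm_cons_erase ha).trans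
      ((List.perm_cons_erase ((List.mem_erase_of_ne hab.symm).2 hb)).cons a)
  simp only [mlExt_perm hp]
  set K := (L.erase a).erase b with hK
  have hKa : ∀ e ∈ K, e ≠ a ∧ e ≠ b := by
    intro e he
    have h2 := ((hL.erase a).mem_erase_iff).1 he
    exact ⟨((hL.mem_erase_iff).1 h2.2).1, h2.1⟩
  have e₁ : ∀ S, mlExt f x₁ K S = mlExt f x K S :=
    mlExt_congr fun e he => hx₁ e (hKa e he).1 (hKa e he).2
  have e₂ : ∀ S, mlExt f x₂ K S = mlExt f x K S :=
    mlExt_congr fun e he => hx₂ e (hKa e he).1 (hKa e he).2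
  have hsub := mlExt_isSubmodular (L := K) hs (fun e _ => h0 e) (fun e _ => h1 e)
  rw [le_div_iff₀ (by linarith)]
  simp only [mlExt, e₁, e₂, ha₁, hb₁, ha₂, hb₂]
  by_cases hS : a ∈ S ∨ b ∈ S
  · rcases hS with h | h
    · simp only [Finset.insert_eq_self.2 h]
      apply le_of_eq; ring
    · simp only [Finset.insert_eq_self.2 h, Finset.insert_eq_self.2 (Finset.mem_insert_of_mem h)]
      apply le_of_eq; ring
  · push Not at hS
    have h2 := hsub (insert a S) (insert b S)
    have h3 : insert a S ∪ insert b S = insert b (insert a S) := by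
      rw [Finset.union_insert, Finset.insert_union, Finset.union_self]
    have h4 : insert a S ∩ insert b S = S := by
      rw [Finset.insert_inter_of_notMem (by simp [hab, hS.1]),
        Finset.inter_eq_left.2 (Finset.subset_insert b S)]
    rw [h3, h4] at h2
    have h5 := mul_nonneg (mul_nonneg ht (mul_self_nonneg s)) (sub_nonneg.2 h2)
    have h6 := mul_nonneg (mul_nonneg ht ht) (mul_nonneg (mul_self_nonneg s) (sub_nonneg.2 h2))
    linarith

theorem exp_le_one_sub_of_le {c a d : ℝ} (hd : 0 ≤ d) (hda : d ≤ a)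
    (ha : a ≤ 1) :
    Real.exp (-c * a + (1 - Real.exp (-c)) * d) ≤ 1 - (1 - Real.exp (-c)) * (a - d) := by
  set κ := 1 - Real.exp (-c) with hκ
  have h1 : κ ≤ c := by linarith [Real.add_one_le_exp (-c)]
  have h2 : Real.exp (-(c - κ)) ≤ 1 := Real.exp_le_one_iff.2 (by linarith)
  have h3 := convexOn_exp.map_sum_le (t := (Finset.univ : Finset (Fin 3)))
    (w := ![1 - a, a - d, d]) (p := ![0, -c, -(c - κ)])
    (by intro i _; fin_cases i <;> simp <;> linarith)
    (by simp [Fin.sum_univ_three]) (by simp)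
  simp only [Fin.sum_univ_three, smul_eq_mul, Matrix.cons_val] at h3
  have h4 : (1 - a) * 0 + (a - d) * -c + d * -(c - κ) = -c * a + κ * d := by ring
  rw [h4, Real.exp_zero] at h3
  nlinarith

/-- The exponential moments of a monotone submodular function of independent elements. -/
theorem mlExt_exp_le (hs : IsSubmodular f) (hm : Monotone f)
    (hf : ∀ S e, f (insert e S) - f S ≤ 1) (h0 : ∀ e, 0 ≤ x e) (h1 : ∀ e, x e ≤ 1) (c : ℝ)
    (L : List (Fin n)) (S : Finset (Fin n)) :
    mlExt (fun S => Real.exp (-c * f S)) x L S ≤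
      Real.exp (-c * f S - (1 - Real.exp (-c)) * (mlExt f x L S - f S)) := by
  induction L generalizing S with
  | nil => simp [mlExt]
  | cons e L ih =>
    have hM := mlExt_monotone hm h0 h1 L (Finset.subset_insert e S)
    have hD := mlExt_insert_sub_le hs hm h0 h1 L e S
    have hk := exp_le_one_sub_of_le (c := c) (d := f (insert e S) - f S -
      (mlExt f x L (insert e S) - mlExt f x L S)) (a := f (insert e S) - f S) (by linarith)
      (by linarith) (hf S e)
    have i1 := ih (insert e S)
    have i2 := ih S
    simp only [mlExt]
    set κ := 1 - Real.exp (-c)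
    set M := mlExt f x L S
    set M' := mlExt f x L (insert e S)
    set p := Real.exp (-c * f S - κ * (M - f S)) with hp
    have hp0 : 0 < p := Real.exp_pos _
    have e1 : Real.exp (-c * f (insert e S) - κ * (M' - f (insert e S))) =
        p * Real.exp (-c * (f (insert e S) - f S) +
          κ * (f (insert e S) - f S - (M' - M))) := by
      rw [← Real.exp_add]; ring_nf
    have e2 : Real.exp (-c * f S - κ * (x e * M' + (1 - x e) * M - f S)) =
        p * Real.exp (-(κ * x e * (M' - M))) := by
      rw [← Real.exp_add]; ring_nf
    rw [e2]
    have h3 := Real.add_one_le_exp (-(κ * x e * (M' - M)))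
    calc _ ≤ x e * (p * (1 - κ * (M' - M))) + (1 - x e) * p := by
          refine add_le_add (mul_le_mul_of_nonneg_left ?_ (h0 e))
            (mul_le_mul_of_nonneg_left i2 (sub_nonneg.2 (h1 e)))
          rw [e1] at i1
          refine i1.trans (mul_le_mul_of_nonneg_left (hk.trans (le_of_eq (by ring))) hp0.le)
      _ = p * (-(κ * x e * (M' - M)) + 1) := by ring
      _ ≤ _ := mul_le_mul_of_nonneg_left h3 hp0.le

theorem exists_hasDerivAt_mlExt (hm : Monotone f)
    (h0 : ∀ e, 0 ≤ x e) (h1 : ∀ e, x e ≤ 1) {s : ℝ} (hs0 : 0 ≤ s) (hs1 : s ≤ 1)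
    (L : List (Fin n)) (S : Finset (Fin n)) :
    ∃ D, HasDerivAt (fun s : ℝ => mlExt f (fun e => s * x e) L S) D s ∧
      (L.map fun e => x e * (mlExt f (fun e => s * x e) L (insert e S) -
        mlExt f (fun e => s * x e) L S)).sum ≤ D := by
  induction L generalizing S with
  | nil => exact ⟨0, hasDerivAt_const _ _, by simp⟩
  | cons e L ih =>
    obtain ⟨D₁, hD₁, hs₁⟩ := ih (insert e S)
    obtain ⟨D₂, hD₂, hs₂⟩ := ih S
    have hsx : HasDerivAt (fun s : ℝ => s * x e) (x e) s := by
      simpa using (hasDerivAt_id s).mul_const (x e)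
    refine ⟨_, (hsx.mul hD₁).add ((hsx.const_sub 1).mul hD₂), ?_⟩
    have y0 : 0 ≤ s * x e := mul_nonneg hs0 (h0 e)
    have y1 : s * x e ≤ 1 := mul_le_one₀ hs1 (h0 e) (h1 e)
    have hM := mlExt_monotone hm (x := fun e => s * x e) (fun e => mul_nonneg hs0 (h0 e))
      (fun e => mul_le_one₀ hs1 (h0 e) (h1 e)) L (Finset.subset_insert e S)
    have h3 := mul_le_mul_of_nonneg_left hs₁ y0
    have h4 := mul_le_mul_of_nonneg_left hs₂ (sub_nonneg.2 y1)
    rw [← List.sum_map_mul_left] at h3 h4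
    have h5 := add_le_add h3 h4
    rw [← List.sum_map_add] at h5
    have h6 : (L.map fun a => x a * (mlExt f (fun e => s * x e) (e :: L) (insert a S) -
        mlExt f (fun e => s * x e) (e :: L) S)).sum = (L.map fun i =>
        s * x e * (x i * (mlExt f (fun e => s * x e) L (insert i (insert e S)) -
          mlExt f (fun e => s * x e) L (insert e S))) +
        (1 - s * x e) * (x i * (mlExt f (fun e => s * x e) L (insert i S) -
          mlExt f (fun e => s * x e) L S))).sum := by
      congr 1
      refine List.map_congr_left fun a _ => ?_
      simp only [mlExt, Finset.insert_comm e a]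
      ring
    rw [List.map_cons, List.sum_cons, h6]
    simp only [mlExt, Finset.insert_idem]
    have h7 := mul_nonneg (mul_nonneg (h0 e) y0) (sub_nonneg.2 hM)
    linarith

theorem sum_indicator_nonneg (Xs : List (Finset (Fin n))) (e : Fin n) :
    0 ≤ (Xs.map fun X => if e ∈ X then (1 : ℝ) else 0).sum := by
  refine List.sum_nonneg fun a ha => ?_
  obtain ⟨X, -, rfl⟩ := List.mem_map.1 ha
  split_ifs <;> norm_num

theorem sum_indicator_le_length (Xs : List (Finset (Fin n))) (e : Fin n) :
    (Xs.map fun X => if e ∈ X then (1 : ℝ) else 0).sum ≤ Xs.length := by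
  have := List.sum_le_card_nsmul (Xs.map fun X => if e ∈ X then (1 : ℝ) else 0) 1 (by
    intro a ha
    obtain ⟨X, -, rfl⟩ := List.mem_map.1 ha
    split_ifs <;> norm_num)
  simpa using this

theorem list_sum_map_finset_sum {ι κ : Type} (l : List ι) (s : Finset κ) (F : ι → κ → ℝ) :
    (l.map fun i => ∑ j ∈ s, F i j).sum = ∑ j ∈ s, (l.map fun i => F i j).sum := by
  induction l with
  | nil => simp
  | cons i l ih => simp [ih, Finset.sum_add_distrib]

theorem list_sum_map_sub_const {ι : Type} (l : List ι) (F : ι → ℝ) (c : ℝ) :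
    (l.map fun i => F i - c).sum = (l.map F).sum - l.length * c := by
  induction l with
  | nil => simp
  | cons i l ih => simp [ih]; ring

/-- The correlation gap: the multilinear extension at an average of indicator vectors. -/
theorem mlExt_avg_ge (hs : IsSubmodular f) (hm : Monotone f) (hf : 0 ≤ f ∅)
    (Xs : List (Finset (Fin n))) (hXs : Xs ≠ []) :
    (1 - 1 / Real.exp 1) * ((Xs.map f).sum / Xs.length) ≤
      mlExt f (fun e => (Xs.map fun X => if e ∈ X then (1 : ℝ) else 0).sum / Xs.length)
        (List.finRange n) ∅ := by
  set x : Fin n → ℝ := fun e => (Xs.map fun X => if e ∈ X then (1 : ℝ) else 0).sum / Xs.length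
    with hx
  set T : ℝ := (Xs.length : ℝ) with hT
  have hT0 : 0 < T := by
    rw [hT]; exact_mod_cast List.length_pos_iff.2 hXs
  have h0 : ∀ e, 0 ≤ x e := fun e => div_nonneg (sum_indicator_nonneg Xs e) hT0.le
  have h1 : ∀ e, x e ≤ 1 := fun e => by
    rw [hx, div_le_one hT0]
    exact sum_indicator_le_length Xs e
  set m : ℝ → Finset (Fin n) → ℝ := fun s => mlExt f (fun e => s * x e) (List.finRange n) with hmm
  set A := (Xs.map f).sum / T with hA
  have key : ∀ s, 0 ≤ s → s ≤ 1 → ∃ D, HasDerivAt (fun s => m s ∅) D s ∧ A - m s ∅ ≤ D := by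
    intro s hs0 hs1
    obtain ⟨D, hD, hle⟩ := exists_hasDerivAt_mlExt hm h0 h1 hs0 hs1 (List.finRange n) ∅
    refine ⟨D, hD, le_trans ?_ hle⟩
    have y0 : ∀ e, 0 ≤ s * x e := fun e => mul_nonneg hs0 (h0 e)
    have y1 : ∀ e, s * x e ≤ 1 := fun e => mul_le_one₀ hs1 (h0 e) (h1 e)
    have hM : Monotone (m s) := mlExt_monotone hm y0 y1 _
    have hS : IsSubmodular (m s) := mlExt_isSubmodular hs (fun e _ => y0 e) (fun e _ => y1 e)
    rw [← List.ofFn_eq_map, List.sum_ofFn]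
    have hX : ∀ X, f X - m s ∅ ≤
        ∑ e, (if e ∈ X then (1 : ℝ) else 0) * (m s (insert e ∅) - m s ∅) := by
      intro X
      have h2 := hS.union_le hM ∅ X
      have h3 := le_mlExt hm y0 y1 (List.finRange n) X
      rw [Finset.empty_union] at h2
      simp only [ite_mul, one_mul, zero_mul, Finset.sum_ite_mem, Finset.univ_inter]
      change f X ≤ m s X at h3
      linarith
    have h4 : (Xs.map fun X => f X - m s ∅).sum ≤ (Xs.map fun X =>
        ∑ e, (if e ∈ X then (1 : ℝ) else 0) * (m s (insert e ∅) - m s ∅)).sum :=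
      List.sum_le_sum fun X _ => hX X
    have h5 : (Xs.map fun X => f X - m s ∅).sum = T * (A - m s ∅) := by
      rw [list_sum_map_sub_const, hA, ← hT]
      field_simp
    have h6 : (Xs.map fun X =>
        ∑ e, (if e ∈ X then (1 : ℝ) else 0) * (m s (insert e ∅) - m s ∅)).sum =
        T * ∑ e, x e * (m s (insert e ∅) - m s ∅) := by
      rw [list_sum_map_finset_sum, Finset.mul_sum]
      refine Finset.sum_congr rfl fun e _ => ?_
      rw [List.sum_map_mul_right, hx]
      field_simp
    rw [h5, h6] at h4
    exact le_of_mul_le_mul_left h4 hT0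
  have hmono : MonotoneOn (fun s => Real.exp s * (m s ∅ - A)) (Set.Icc 0 1) := by
    have hd : ∀ s ∈ Set.Icc (0 : ℝ) 1, ∃ D, HasDerivAt (fun s => Real.exp s * (m s ∅ - A)) D s ∧
        0 ≤ D := by
      rintro s ⟨hs0, hs1⟩
      obtain ⟨D, hD, hle⟩ := key s hs0 hs1
      refine ⟨_, (Real.hasDerivAt_exp s).mul (hD.sub_const A), ?_⟩
      have := mul_nonneg (Real.exp_pos s).le (sub_nonneg.2 hle)
      linarith
    refine monotoneOn_of_deriv_nonneg (convex_Icc 0 1) ?_ ?_ ?_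
    · intro s hs
      obtain ⟨D, hD, -⟩ := hd s hs
      exact hD.continuousAt.continuousWithinAt
    · intro s hs
      obtain ⟨D, hD, -⟩ := hd s (interior_subset hs)
      exact hD.differentiableAt.differentiableWithinAt
    · intro s hs
      obtain ⟨D, hD, h⟩ := hd s (interior_subset hs)
      rwa [hD.deriv]
  have hfin := hmono (Set.left_mem_Icc.2 zero_le_one) (Set.right_mem_Icc.2 zero_le_one)
    zero_le_one
  simp only [hmm, zero_mul, one_mul, mlExt_zero, Real.exp_zero] at hfin
  have he := Real.exp_pos 1
  have h7 : (1 - 1 / Real.exp 1) * A = (Real.exp 1 * A - A) / Real.exp 1 := by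
    field_simp
  rw [h7, div_le_iff₀ he]
  linarith

end mlExt

/-! ### Analysis of the thresholding algorithm -/

section threshold

variable {n m : ℕ} {O : Finset (Fin n) → Fin m → ℝ} {g : Finset (Fin n) → SetAlg n m ℝ}
  {φ : Finset (Fin n) → ℝ}

theorem maxSingleton_always (hg : ∀ X P, P (φ X) → (g X).Always O P) (L : List (Fin n)) (d : ℝ)
    {B : ℝ} (hd : d ≤ B) (hB : ∀ e ∈ L, φ {e} ≤ B) :
    (maxSingleton g L d).Always O (fun r => d ≤ r ∧ r ≤ B ∧ ∀ e ∈ L, φ {e} ≤ r) := by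
  induction L generalizing d with
  | nil => exact ⟨le_rfl, hd, by simp⟩
  | cons e L ih =>
    rw [maxSingleton, QueryAlg.always_bind]
    refine hg _ _ ?_
    refine (ih (max d (φ {e})) (max_le hd (hB e List.mem_cons_self))
      fun e he => hB e (List.mem_cons_of_mem _ he)).mono ?_
    rintro r ⟨h1, h2, h3⟩
    refine ⟨(le_max_left _ _).trans h1, h2, ?_⟩
    simp only [List.mem_cons, forall_eq_or_imp]
    exact ⟨(le_max_right _ _).trans h1, h3⟩

theorem thresholdPass_always (hg : ∀ X P, P (φ X) → (g X).Always O P) (hs : IsSubmodular φ)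
    (hm : Monotone φ) {G : List (Fin n)} {k : ℕ} {w b q B : ℝ} (hw : 0 ≤ w) (hq : 0 ≤ q)
    (hgain : ∀ X, (∀ e ∈ G, φ (insert e X) - φ X ≤ b) → (1 - q) * (B - φ X) ≤ w)
    (L : List (Fin n)) (X : Finset (Fin n)) (hX : X.card ≤ k)
    (hb : X.card < k → ∀ e ∈ G, φ (insert e X) - φ X ≤ b) (hB : B - φ X ≤ q ^ X.card * B) :
    (thresholdPass g k w L X (φ X)).Always O (fun r => r.2 = φ r.1 ∧ X ⊆ r.1 ∧ r.1.card ≤ k ∧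
      B - φ r.1 ≤ q ^ r.1.card * B ∧
      (r.1.card < k → ∀ e ∈ L, φ (insert e r.1) - φ r.1 ≤ w)) := by
  induction L generalizing X with
  | nil => exact ⟨rfl, subset_rfl, hX, hB, by simp⟩
  | cons e L ih =>
    rw [thresholdPass]
    split_ifs with h
    · rw [QueryAlg.always_bind]
      refine hg _ _ ?_
      split_ifs with hwz
      · have hc : (insert e X).card = X.card + 1 := Finset.card_insert_of_notMem h.2
        refine (ih (insert e X) (by omega) (fun _ a ha =>
          (hs.insert_sub_le hm (Finset.subset_insert e X) a).trans (hb h.1 a ha)) ?_).mono ?_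
        · have h1 := hgain X (hb h.1)
          have h2 := mul_le_mul_of_nonneg_left hB hq
          rw [hc, pow_succ]
          linarith
        · rintro r ⟨h1, h2, h3, h4, h5⟩
          refine ⟨h1, (Finset.subset_insert e X).trans h2, h3, h4, fun hr => ?_⟩
          simp only [List.mem_cons, forall_eq_or_imp]
          refine ⟨?_, h5 hr⟩
          rw [Finset.insert_eq_self.2 (h2 (Finset.mem_insert_self e X)), sub_self]
          exact hw
      · refine (ih X hX hb hB).mono ?_
        rintro r ⟨h1, h2, h3, h4, h5⟩
        refine ⟨h1, h2, h3, h4, fun hr => ?_⟩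
        simp only [List.mem_cons, forall_eq_or_imp]
        exact ⟨(hs.insert_sub_le hm h2 e).trans (not_le.1 hwz).le, h5 hr⟩
    · refine (ih X hX hb hB).mono ?_
      rintro r ⟨h1, h2, h3, h4, h5⟩
      refine ⟨h1, h2, h3, h4, fun hr => ?_⟩
      simp only [List.mem_cons, forall_eq_or_imp]
      refine ⟨?_, h5 hr⟩
      have he : e ∈ X := by
        by_contra he
        exact h ⟨(Finset.card_le_card h2).trans_lt hr, he⟩
      rw [Finset.insert_eq_self.2 (h2 he), sub_self]
      exact hw

theorem thresholdPasses_always (hg : ∀ X P, P (φ X) → (g X).Always O P) (hs : IsSubmodular φ)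
    (hm : Monotone φ) {G : List (Fin n)} {k : ℕ} {η d q B : ℝ} (hη0 : 0 ≤ η) (hη1 : η ≤ 1)
    (hd : 0 ≤ d) (hq : 0 ≤ q)
    (hgain : ∀ X b, 0 ≤ b → (∀ e ∈ G, φ (insert e X) - φ X ≤ b) →
      (1 - q) * (B - φ X) ≤ (1 - η) * b)
    (c a : ℕ) (X : Finset (Fin n)) (hX : X.card ≤ k)
    (hb : X.card < k → ∀ e ∈ G, φ (insert e X) - φ X ≤ (1 - η) ^ (a - 1) * d)
    (hB : B - φ X ≤ q ^ X.card * B) :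
    (thresholdPasses g k G ((List.range' a c).map fun j => (1 - η) ^ j * d) X (φ X)).Always O
      (fun Y => Y.card ≤ k ∧ B - φ Y ≤ q ^ Y.card * B ∧
        (Y.card < k → ∀ e ∈ G, φ (insert e Y) - φ Y ≤ (1 - η) ^ (a + c - 1) * d)) := by
  have h0 : 0 ≤ 1 - η := by linarith
  induction c generalizing a X with
  | zero => exact ⟨hX, hB, hb⟩
  | succ c ih =>
    rw [List.range'_succ, List.map_cons, thresholdPasses, QueryAlg.always_bind]
    refine (thresholdPass_always hg hs hm (w := (1 - η) ^ a * d) (by positivity) hq ?_ G X hX hb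
      hB).mono ?_
    · intro Y hY
      refine (hgain Y _ (by positivity) hY).trans ?_
      rw [← mul_assoc]
      refine mul_le_mul_of_nonneg_right ?_ hd
      rw [← pow_succ']
      exact pow_le_pow_of_le_one h0 (by linarith) (by omega)
    · rintro ⟨Y, y⟩ ⟨h1, -, h3, h4, h5⟩
      dsimp only at h1 h3 h4 h5 ⊢
      subst h1
      have := ih (a + 1) Y h3 h5 h4
      rwa [show a + (c + 1) - 1 = a + 1 + c - 1 by omega]

theorem card_padTo {k : ℕ} {G : List (Fin n)} (hG : G.Nodup) (hk : k ≤ G.length)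
    {X : Finset (Fin n)} (hX : X.card ≤ k) : (padTo k G X).card = k := by
  have hnd : ((G.filter (fun e => e ∉ X)).take (k - X.card)).Nodup :=
    (hG.filter _).sublist (List.take_sublist _ _)
  have hdisj : Disjoint X ((G.filter (fun e => e ∉ X)).take (k - X.card)).toFinset := by
    rw [Finset.disjoint_left]
    intro e he h
    have := List.mem_of_mem_take (List.mem_toFinset.1 h)
    simp only [List.mem_filter, decide_eq_true_eq] at this
    exact this.2 he
  have hlen : k - X.card ≤ (G.filter (fun e => e ∉ X)).length := by
    have h1 : G.toFinset.card = G.length := List.toFinset_card_of_nodup hG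
    have h2 : (G.filter (fun e => e ∉ X)).toFinset = G.toFinset \ X := by
      ext e; simp
    have h3 := List.toFinset_card_of_nodup (hG.filter (fun e => decide (e ∉ X)))
    rw [h2] at h3
    have h4 := Finset.le_card_sdiff X G.toFinset
    omega
  rw [padTo, Finset.card_union_of_disjoint hdisj, List.toFinset_card_of_nodup hnd,
    List.length_take]
  omega

theorem one_sub_exp_neg_ge {t : ℝ} (h0 : 0 ≤ t) (h1 : t ≤ 1) :
    (1 - 1 / Real.exp 1) * t ≤ 1 - Real.exp (-t) := by
  have h := convexOn_exp.2 (Set.mem_univ 0) (Set.mem_univ (-1)) (sub_nonneg.2 h1) h0 (by ring)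
  simp only [smul_eq_mul, Real.exp_zero, Real.exp_neg] at h
  have h2 : (1 - t) * 0 + t * -1 = -t := by ring
  rw [h2] at h
  rw [one_div, Real.exp_neg]
  rw [Real.exp_neg] at h
  linarith

theorem pow_floor_log_div_lt {x η : ℝ} (hx : 0 < x) (h0 : 0 < η) (h1 : η < 1) :
    (1 - η) ^ (⌊Real.log x / Real.log (1 / (1 - η))⌋₊ + 1) < 1 / x := by
  have hl : 0 < Real.log (1 / (1 - η)) := Real.log_pos (by
    rw [lt_div_iff₀ (by linarith)]; linarith)
  have h := Nat.lt_floor_add_one (Real.log x / Real.log (1 / (1 - η)))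
  rw [div_lt_iff₀ hl, one_div, Real.log_inv] at h
  rw [← Real.log_lt_log_iff (pow_pos (by linarith) _) (by positivity), Real.log_pow, one_div,
    Real.log_inv, one_div, Real.log_inv]
  push_cast at h ⊢
  linarith

theorem exp_one_bounds : 0.632 < 1 - 1 / Real.exp 1 ∧ 1 - 1 / Real.exp 1 < 0.6322 := by
  have h1 := Real.exp_one_gt_d9
  have h2 := Real.exp_one_lt_d9
  have h0 := Real.exp_pos 1
  constructor
  · rw [lt_sub_comm, div_lt_iff₀ h0]; nlinarith
  · rw [sub_lt_comm, lt_div_iff₀ h0]; nlinarith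

/-- The thresholding algorithm with cardinality bound `k₁`, compared with sets of size `k`. -/
theorem thresholdGreedy_always (hg : ∀ X P, P (φ X) → (g X).Always O P) (hs : IsSubmodular φ)
    (hm : Monotone φ) (h0 : φ ∅ = 0) {G : List (Fin n)} (hG : G.Nodup)
    (hout : ∀ e, e ∉ G → ∀ X, φ (insert e X) ≤ φ X) {k k₁ : ℕ} (hk : 1 ≤ k) (hkn : k ≤ n)
    (hk₁ : k₁ ≤ k) (hk₁G : k₁ ≤ G.length) {η : ℝ} (hη0 : 0 < η)
    (hη1 : η < (1 - 1 / Real.exp 1) / 2) {S : Finset (Fin n)} (hS : S.card ≤ k) :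
    (thresholdGreedy g k₁ G η).Always O (fun X => X.card = k₁ ∧
      ((1 - 1 / Real.exp 1) * (k₁ / k) - η) * φ S ≤ φ X) := by
  have he := exp_one_bounds
  have hkpos : (0 : ℝ) < k := by exact_mod_cast hk
  have hφ0 : ∀ X, 0 ≤ φ X := fun X => h0 ▸ hm (Finset.empty_subset X)
  obtain ⟨Y, hYk, hSY, hYs⟩ : ∃ Y : Finset (Fin n), Y.card ≤ k ∧ φ S ≤ φ Y ∧
      ∀ e, φ {e} ≤ φ Y := by
    obtain ⟨Y, hY, hmax⟩ := Finset.exists_max_image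
      (Finset.univ.filter fun Y : Finset (Fin n) => Y.card ≤ k) φ ⟨S, by simpa using hS⟩
    simp only [Finset.mem_filter, Finset.mem_univ, true_and] at hY hmax
    exact ⟨Y, hY, hmax S hS, fun e => hmax {e} (by simpa using hk)⟩
  set B := φ Y with hBdef
  have hB0 : 0 ≤ B := hφ0 Y
  have hH : ∀ X b, 0 ≤ b → (∀ e ∈ G, φ (insert e X) - φ X ≤ b) → B - φ X ≤ k * b := by
    intro X b hb h
    have h1 := hm (Finset.subset_union_right (s₁ := X) (s₂ := Y))
    have h2 := hs.union_le hm X Y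
    have h3 : ∑ e ∈ Y, (φ (insert e X) - φ X) ≤ Y.card • b := by
      refine Finset.sum_le_card_nsmul _ _ _ fun e _ => ?_
      by_cases heG : e ∈ G
      · exact h e heG
      · linarith [hout e heG X]
    rw [nsmul_eq_mul] at h3
    have h4 : (Y.card : ℝ) * b ≤ k * b :=
      mul_le_mul_of_nonneg_right (by exact_mod_cast hYk) hb
    linarith
  set q : ℝ := 1 - (1 - η) / k with hq
  have hq0 : 0 ≤ q := by
    have : (1 - η) / k ≤ 1 := by
      rw [div_le_one hkpos]
      have : (1 : ℝ) ≤ k := by exact_mod_cast hk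
      linarith
    linarith
  rw [thresholdGreedy, QueryAlg.always_bind]
  refine (maxSingleton_always hg G 0 hB0 fun e _ => hYs e).mono ?_
  rintro d ⟨hd0, hdB, hds⟩
  rw [QueryAlg.always_bind, List.range_eq_range', ← h0]
  refine (thresholdPasses_always hg hs hm hη0.le (by linarith) hd0 hq0 (B := B) ?_ _ 0 ∅
    (by simp) ?_ (by simp [h0])).mono ?_
  · intro X b hb h
    have := hH X b hb h
    have h1 : (1 - q) * (B - φ X) = (1 - η) * ((B - φ X) / k) := by rw [hq]; ring
    rw [h1]
    refine mul_le_mul_of_nonneg_left ?_ (by linarith)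
    rw [div_le_iff₀ hkpos]
    linarith
  · intro _ e he
    have := hds e he
    simpa [h0] using this
  · rintro X ⟨hXk, hXB, hXm⟩
    refine ⟨card_padTo hG hk₁G hXk, ?_⟩
    have hpad : φ X ≤ φ (padTo k₁ G X) := hm Finset.subset_union_left
    refine le_trans ?_ hpad
    have hβ1 : (k₁ : ℝ) / k ≤ 1 := by
      rw [div_le_one hkpos]; exact_mod_cast hk₁
    have hβ0 : (0 : ℝ) ≤ k₁ / k := by positivity
    set β : ℝ := k₁ / k with hβ
    suffices h : ((1 - 1 / Real.exp 1) * β - η) * B ≤ φ X by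
      by_cases hc : 0 ≤ (1 - 1 / Real.exp 1) * β - η
      · exact (mul_le_mul_of_nonneg_left hSY hc).trans h
      · exact (mul_nonpos_of_nonpos_of_nonneg (not_le.1 hc).le (hφ0 S)).trans (hφ0 X)
    rcases hXk.lt_or_eq with hlt | heq
    · have h1 := hH X _ (by
        have : 0 ≤ 1 - η := by linarith
        positivity) (hXm hlt)
      simp only [zero_add, Nat.add_sub_cancel] at h1
      set J := ⌊Real.log (n / η) / Real.log (1 / (1 - η))⌋₊ with hJ
      have hn : (0 : ℝ) < n := hkpos.trans_le (by exact_mod_cast hkn)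
      have h2 := pow_floor_log_div_lt (x := n / η) (by positivity) hη0 (by linarith)
      rw [← hJ, pow_succ, one_div_div, lt_div_iff₀ hn] at h2
      have h1η : 0 < 1 - η := by linarith
      have h3 : (k : ℝ) * (1 - η) ^ J * (1 - η) ≤ η := by
        have : (k : ℝ) * ((1 - η) ^ J * (1 - η)) ≤ n * ((1 - η) ^ J * (1 - η)) :=
          mul_le_mul_of_nonneg_right (by exact_mod_cast hkn) (by positivity)
        linarith
      have h4 : (k : ℝ) * (1 - η) ^ J ≤ 1 / Real.exp 1 + η := by
        by_contra hcon
        have := mul_lt_mul_of_pos_right (not_le.1 hcon) h1η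
        nlinarith
      have h5 : (k : ℝ) * ((1 - η) ^ J * d) ≤ (1 / Real.exp 1 + η) * B := by
        rw [← mul_assoc]
        exact mul_le_mul h4 hdB hd0 (by positivity)
      have h6 : ((1 - 1 / Real.exp 1) * β - η) * B ≤ ((1 - 1 / Real.exp 1) - η) * B := by
        refine mul_le_mul_of_nonneg_right ?_ hB0
        nlinarith
      linarith
    · have h1 : q ^ X.card ≤ Real.exp (-((1 - η) * β)) := by
        have h2 : q ≤ Real.exp (-((1 - η) / k)) := by
          linarith [Real.add_one_le_exp (-((1 - η) / k))]
        refine (pow_le_pow_left₀ hq0 h2 _).trans (le_of_eq ?_)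
        rw [← Real.exp_nat_mul, heq, hβ]
        ring_nf
      have h3 := one_sub_exp_neg_ge (t := (1 - η) * β) (mul_nonneg (by linarith) hβ0)
        (mul_le_one₀ (by linarith) hβ0 hβ1)
      have h4 : ((1 - 1 / Real.exp 1) * β - η) ≤ 1 - q ^ X.card := by
        have h5 : (1 - 1 / Real.exp 1) * β * η ≤ η :=
          mul_le_of_le_one_left hη0.le (mul_le_one₀ (by linarith) hβ0 hβ1)
        linarith
      have := mul_le_mul_of_nonneg_right h4 hB0
      linarith

end threshold

/-! ### The number of queries -/

section queries

variable {n m : ℕ} {O : Finset (Fin n) → Fin m → ℝ}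

theorem maxSingleton_queries {g : Finset (Fin n) → SetAlg n m ℝ}
    (hg : ∀ X, (g X).queries O ≤ 1) (L : List (Fin n)) (d : ℝ) :
    (maxSingleton g L d).queries O ≤ L.length := by
  induction L generalizing d with
  | nil => exact le_rfl
  | cons e L ih =>
    rw [maxSingleton, List.length_cons, add_comm]
    exact QueryAlg.queries_bind_le (hg _) fun z => ih _

theorem thresholdPass_queries {g : Finset (Fin n) → SetAlg n m ℝ}
    (hg : ∀ X, (g X).queries O ≤ 1) (k : ℕ) (w : ℝ) (L : List (Fin n)) (X : Finset (Fin n))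
    (x : ℝ) : (thresholdPass g k w L X x).queries O ≤ L.length := by
  induction L generalizing X x with
  | nil => exact le_rfl
  | cons e L ih =>
    rw [thresholdPass, List.length_cons, add_comm]
    split_ifs
    · refine QueryAlg.queries_bind_le (hg _) fun z => ?_
      split_ifs <;> exact ih _ _
    · exact (ih _ _).trans (Nat.le_add_left _ _)

theorem thresholdPasses_queries {g : Finset (Fin n) → SetAlg n m ℝ}
    (hg : ∀ X, (g X).queries O ≤ 1) (k : ℕ) (G : List (Fin n)) (W : List ℝ)
    (X : Finset (Fin n)) (x : ℝ) :
    (thresholdPasses g k G W X x).queries O ≤ W.length * G.length := by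
  induction W generalizing X x with
  | nil => simp [thresholdPasses, QueryAlg.queries_pure]
  | cons w W ih =>
    rw [thresholdPasses, List.length_cons, Nat.succ_mul, add_comm]
    exact QueryAlg.queries_bind_le (thresholdPass_queries hg k w G X x) fun r => ih _ _

theorem thresholdGreedy_queries {g : Finset (Fin n) → SetAlg n m ℝ}
    (hg : ∀ X, (g X).queries O ≤ 1) (k : ℕ) (G : List (Fin n)) (η : ℝ) :
    (thresholdGreedy g k G η).queries O ≤
      (⌊Real.log (n / η) / Real.log (1 / (1 - η))⌋₊ + 2) * G.length := by
  rw [thresholdGreedy]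
  set J := ⌊Real.log (n / η) / Real.log (1 / (1 - η))⌋₊
  refine (QueryAlg.queries_bind_le (maxSingleton_queries hg G 0) (d := (J + 1) * G.length + 0)
    fun d => QueryAlg.queries_bind_le ?_ fun X => (QueryAlg.queries_pure _).le).trans
      (le_of_eq (by ring))
  simpa using thresholdPasses_queries hg k G
    ((List.range (J + 1)).map fun j => (1 - η) ^ j * d) ∅ 0

theorem normalizedMarginals_queries (V : Fin m → ℝ) (S₁ : Finset (Fin n)) (y : Fin m → ℝ)
    (X : Finset (Fin n)) : (normalizedMarginals V S₁ y X).queries O ≤ 1 :=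
  QueryAlg.queries_bind_le (c := 1) (d := 0) le_rfl fun _ => le_rfl

theorem mwuRounds_queries (V : Fin m → ℝ) (S₁ : Finset (Fin n)) (y : Fin m → ℝ) (k₁ : ℕ) (η : ℝ)
    (T : ℕ) (lam : Fin m → ℝ) :
    (mwuRounds V S₁ y k₁ η T lam).queries O ≤
      T * ((⌊Real.log (n / η) / Real.log (1 / (1 - η))⌋₊ + 2) * n + 1) := by
  induction T generalizing lam with
  | zero => simp [mwuRounds, QueryAlg.queries_pure]
  | succ T ih =>
    rw [mwuRounds]
    set J := ⌊Real.log (n / η) / Real.log (1 / (1 - η))⌋₊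
    have hlen : ((List.finRange n).filter (fun e => e ∉ S₁)).length ≤ n := by
      simpa using List.length_filter_le (fun e => decide (e ∉ S₁)) (List.finRange n)
    refine (QueryAlg.queries_bind_le (c := (J + 2) * n) ?_ fun X =>
      QueryAlg.queries_bind_le (normalizedMarginals_queries V S₁ y X) fun v =>
        QueryAlg.queries_bind_le (ih _) fun Xs => (QueryAlg.queries_pure _).le).trans
      (le_of_eq (by ring))
    exact (thresholdGreedy_queries (fun X => QueryAlg.queries_bind_le (c := 1) (d := 0)
      (normalizedMarginals_queries V S₁ y X) fun _ => le_rfl) k₁ _ η).trans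
        (Nat.mul_le_mul_left _ hlen)

theorem stageOne_queries (V : Fin m → ℝ) (ε : ℝ) (L : List (Fin n)) (S : Finset (Fin n))
    (y : Fin m → ℝ) : (stageOne V ε L S y).queries O ≤ L.length := by
  induction L generalizing S y with
  | nil => exact le_rfl
  | cons e L ih =>
    rw [stageOne, List.length_cons, add_comm]
    refine QueryAlg.queries_bind_le (c := 1) le_rfl fun z => ?_
    split_ifs <;> exact ih _ _

theorem mergePairs_queries (t : ℕ) (L : List (Fin n × Fin n)) (B B' : Finset (Fin n)) :
    (mergePairs (m := m) t L B B').queries O = 0 := by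
  induction L generalizing B B' with
  | nil => rfl
  | cons p L ih =>
    obtain ⟨a, b⟩ := p
    rw [mergePairs, QueryAlg.queries, ← Nat.le_zero]
    refine Finset.sup_le fun u _ => ?_
    split_ifs <;> exact (ih _ _).le

theorem swapMerge_queries (t : ℕ) (C : Finset (Fin n)) (L : List (Finset (Fin n))) :
    (swapMerge (m := m) t C L).queries O ≤ 0 := by
  induction L generalizing t C with
  | nil => exact le_rfl
  | cons B L ih =>
    exact QueryAlg.queries_bind_le (c := 0) (d := 0) (mergePairs_queries _ _ _ _).le
      fun _ => ih _ _

theorem mwuAlgorithm_queries (k : ℕ) (V : Fin m → ℝ) (ε δ : ℝ) :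
    (mwuAlgorithm n m k V ε δ).queries O ≤ 1 + (n + ⌈2 * Real.log m / (δ / 2) ^ 2⌉₊ *
      ((⌊Real.log (n / (δ / 2)) / Real.log (1 / (1 - δ / 2))⌋₊ + 2) * n + 1)) := by
  rw [mwuAlgorithm]
  refine QueryAlg.queries_bind_le (c := 1) le_rfl fun y₀ => QueryAlg.queries_bind_le
    ((stageOne_queries V ε (List.finRange n) ∅ y₀).trans (by simp)) fun r => ?_
  refine QueryAlg.queries_bind_le (d := 0) (mwuRounds_queries V r.1 r.2 _ _ _ _) fun Xs => ?_
  refine QueryAlg.queries_bind_le (c := 0) (d := 0) ?_ fun _ => le_rfl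
  cases Xs with
  | nil => exact le_rfl
  | cons X L => exact swapMerge_queries _ _ _

theorem query_bound {δ : ℝ} (hm : 2 ≤ m) (hn : 1 ≤ n) (hδ0 : 0 < δ)
    (hδ1 : δ < 1 - 1 / Real.exp 1) :
    1 + (n + (⌈2 * Real.log m / (δ / 2) ^ 2⌉₊ : ℝ) *
      (((⌊Real.log (n / (δ / 2)) / Real.log (1 / (1 - δ / 2))⌋₊ : ℝ) + 2) * n + 1)) ≤
      200 * (n / δ ^ 3 * Real.log m * Real.log (n / δ)) := by
  have he := exp_one_bounds
  have hn' : (1 : ℝ) ≤ n := by exact_mod_cast hn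
  have hn0 : (0 : ℝ) < n := by linarith
  have hM : 0.69 < Real.log m := by
    have h1 := Real.log_two_gt_d9
    have h2 : Real.log 2 ≤ Real.log m := Real.log_le_log (by norm_num) (by exact_mod_cast hm)
    linarith
  have hΛ : 1 / 3 ≤ Real.log (n / δ) := by
    have h1 : (1.5 : ℝ) ≤ n / δ := by
      rw [le_div_iff₀ hδ0]; nlinarith
    have h2 := Real.one_sub_inv_le_log_of_pos (x := n / δ) (by positivity)
    have h3 : (n / δ)⁻¹ ≤ (1.5 : ℝ)⁻¹ := inv_anti₀ (by norm_num) h1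
    norm_num at h3
    rw [inv_div] at h2
    linarith
  set M := Real.log m
  set Λ := Real.log (n / δ)
  have hT : (⌈2 * M / (δ / 2) ^ 2⌉₊ : ℝ) ≤ 10 * M / δ ^ 2 := by
    have h1 := (Nat.ceil_lt_add_one (a := 2 * M / (δ / 2) ^ 2) (by positivity)).le
    have h2 : 2 * M / (δ / 2) ^ 2 = 8 * M / δ ^ 2 := by field_simp; ring
    have h3 : 1 ≤ 2 * M / δ ^ 2 := by
      rw [le_div_iff₀ (by positivity)]; nlinarith
    have h4 : 10 * M / δ ^ 2 = 8 * M / δ ^ 2 + 2 * M / δ ^ 2 := by ring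
    linarith
  have hJ : (⌊Real.log (n / (δ / 2)) / Real.log (1 / (1 - δ / 2))⌋₊ : ℝ) + 2 ≤ 12 * Λ / δ := by
    have h1 : δ / 2 ≤ Real.log (1 / (1 - δ / 2)) := by
      have := Real.log_le_sub_one_of_pos (x := 1 - δ / 2) (by linarith)
      rw [one_div, Real.log_inv]
      linarith
    have h2 : Real.log (n / (δ / 2)) ≤ 4 * Λ := by
      rw [show (n : ℝ) / (δ / 2) = 2 * (n / δ) by field_simp,
        Real.log_mul (by norm_num) (by positivity)]
      have := Real.log_two_lt_d9
      change Real.log 2 + Λ ≤ _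
      linarith
    have h3 : Real.log (n / (δ / 2)) / Real.log (1 / (1 - δ / 2)) ≤ 4 * Λ / (δ / 2) :=
      div_le_div₀ (by positivity) h2 (by positivity) h1
    have h4 : (⌊Real.log (n / (δ / 2)) / Real.log (1 / (1 - δ / 2))⌋₊ : ℝ) ≤ 4 * Λ / (δ / 2) := by
      refine le_trans (Nat.floor_le (div_nonneg (Real.log_nonneg ?_) (by linarith))) h3
      rw [le_div_iff₀ (by positivity)]; linarith
    have h5 : 4 * Λ / (δ / 2) = 8 * Λ / δ := by field_simp; ring
    have h6 : 2 ≤ 4 * Λ / δ := by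
      rw [le_div_iff₀ hδ0]; linarith
    have h7 : 12 * Λ / δ = 8 * Λ / δ + 4 * Λ / δ := by ring
    linarith
  have hA : (((⌊Real.log (n / (δ / 2)) / Real.log (1 / (1 - δ / 2))⌋₊ : ℝ) + 2) * n + 1) ≤
      15 * Λ / δ * n := by
    have h1 := mul_le_mul_of_nonneg_right hJ hn0.le
    have h2 : 1 ≤ 3 * Λ / δ * n := by
      have : 1 ≤ 3 * Λ / δ := by rw [le_div_iff₀ hδ0]; linarith
      nlinarith
    have h3 : 15 * Λ / δ * n = 12 * Λ / δ * n + 3 * Λ / δ * n := by ring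
    linarith
  have hU : 1 + (n : ℝ) ≤ 10 * (n / δ ^ 3 * M * Λ) := by
    have h1 : 1 ≤ 1 / δ ^ 3 := by
      rw [le_div_iff₀ (by positivity), one_mul]
      exact pow_le_one₀ hδ0.le (by linarith)
    have h2 : 1 ≤ 5 * (M * Λ) := by nlinarith
    have h3 : 2 * (n : ℝ) ≤ 2 * n * (1 / δ ^ 3 * (5 * (M * Λ))) :=
      le_mul_of_one_le_right (by positivity) (one_le_mul_of_one_le_of_one_le h1 h2)
    have h4 : 10 * (n / δ ^ 3 * M * Λ) = 2 * n * (1 / δ ^ 3 * (5 * (M * Λ))) := by ring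
    linarith
  have hP := mul_le_mul hT hA (by positivity) (by positivity)
  have h4 : 10 * M / δ ^ 2 * (15 * Λ / δ * n) = 150 * (n / δ ^ 3 * M * Λ) := by
    field_simp; ring
  have h5 : 0 ≤ n / δ ^ 3 * M * Λ := by positivity
  linarith

end queries

/-! ### Swap rounding -/

section rounding

variable {n m : ℕ} {O : Finset (Fin n) → Fin m → ℝ} {φ : Finset (Fin n) → ℝ}

theorem mergePairs_always (t : ℕ) {L : List (Fin n × Fin n)} {B B' : Finset (Fin n)}
    (h₁ : (L.map Prod.fst).Nodup) (h₂ : (L.map Prod.snd).Nodup)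
    (hB : (L.map Prod.fst).toFinset = B \ B') (hB' : (L.map Prod.snd).toFinset = B' \ B) :
    (mergePairs (m := m) t L B B').Always O (fun C => C.card = B.card) := by
  induction L generalizing B B' with
  | nil => exact rfl
  | cons p L ih =>
    obtain ⟨a, b⟩ := p
    simp only [List.map_cons, List.nodup_cons, List.toFinset_cons] at h₁ h₂ hB hB'
    have ha : a ∈ B \ B' := hB ▸ Finset.mem_insert_self a _
    have hb : b ∈ B' \ B := hB' ▸ Finset.mem_insert_self b _
    rw [Finset.mem_sdiff] at ha hb
    have hBe : ∀ e, e ∈ (L.map Prod.fst).toFinset ↔ e ≠ a ∧ e ∈ B \ B' := by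
      intro e
      rw [← hB, Finset.mem_insert]
      have : a ∉ (L.map Prod.fst).toFinset := by simpa using h₁.1
      by_cases h : e = a
      · subst h; simp only [this, ne_eq, not_true, false_and]
      · simp [h]
    have hBe' : ∀ e, e ∈ (L.map Prod.snd).toFinset ↔ e ≠ b ∧ e ∈ B' \ B := by
      intro e
      rw [← hB', Finset.mem_insert]
      have : b ∉ (L.map Prod.snd).toFinset := by simpa using h₂.1
      by_cases h : e = b
      · subst h; simp only [this, ne_eq, not_true, false_and]
      · simp [h]
    have hab : a ≠ b := fun h => hb.2 (h ▸ ha.1)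
    rw [mergePairs, QueryAlg.Always]
    intro u
    split_ifs
    · refine (ih h₁.2 h₂.2 ?_ ?_).mono ?_
      · ext e
        rw [hBe]
        simp only [Finset.mem_sdiff, Finset.mem_insert, Finset.mem_erase]
        grind
      · ext e
        rw [hBe']
        simp only [Finset.mem_sdiff, Finset.mem_insert, Finset.mem_erase]
        grind
      · intro C hC
        rw [hC, Finset.card_insert_of_notMem (by simp [hb.2]), Finset.card_erase_add_one ha.1]
    · refine ih h₁.2 h₂.2 ?_ ?_
      · ext e
        rw [hBe]
        simp only [Finset.mem_sdiff, Finset.mem_insert, Finset.mem_erase]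
        grind
      · ext e
        rw [hBe']
        simp only [Finset.mem_sdiff, Finset.mem_insert, Finset.mem_erase]
        grind

theorem mergePairs_expect (hs : IsSubmodular φ) (t : ℕ) {T : ℝ} (hT : 0 < T) {r : Fin n → ℝ}
    (hr0 : ∀ e, 0 ≤ r e) (hr1 : ∀ e, r e + t + 1 ≤ T) {L : List (Fin n × Fin n)}
    {B B' : Finset (Fin n)} (h₁ : (L.map Prod.fst).Nodup) (h₂ : (L.map Prod.snd).Nodup)
    (hB : (L.map Prod.fst).toFinset = B \ B') (hB' : (L.map Prod.snd).toFinset = B' \ B) :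
    mlExt φ (fun e => (t * (if e ∈ B then 1 else 0) + (if e ∈ B' then 1 else 0) + r e) / T)
        (List.finRange n) ∅ ≤
      (mergePairs (m := m) t L B B').expect O (fun C =>
        mlExt φ (fun e => ((t + 1) * (if e ∈ C then 1 else 0) + r e) / T)
          (List.finRange n) ∅) := by
  induction L generalizing B B' with
  | nil =>
    simp only [List.map_nil, List.toFinset_nil] at hB hB'
    have : B = B' := (Finset.sdiff_eq_empty_iff_subset.1 hB.symm).antisymm
      (Finset.sdiff_eq_empty_iff_subset.1 hB'.symm)
    subst this
    refine le_of_eq (mlExt_congr (fun e _ => ?_) _)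
    ring
  | cons p L ih =>
    obtain ⟨a, b⟩ := p
    simp only [List.map_cons, List.nodup_cons, List.toFinset_cons] at h₁ h₂ hB hB'
    have ha : a ∈ B \ B' := hB ▸ Finset.mem_insert_self a _
    have hb : b ∈ B' \ B := hB' ▸ Finset.mem_insert_self b _
    rw [Finset.mem_sdiff] at ha hb
    have hBe : ∀ e, e ∈ (L.map Prod.fst).toFinset ↔ e ≠ a ∧ e ∈ B \ B' := by
      intro e
      rw [← hB, Finset.mem_insert]
      have : a ∉ (L.map Prod.fst).toFinset := by simpa using h₁.1
      by_cases h : e = a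
      · subst h; simp only [this, ne_eq, not_true, false_and]
      · simp [h]
    have hBe' : ∀ e, e ∈ (L.map Prod.snd).toFinset ↔ e ≠ b ∧ e ∈ B' \ B := by
      intro e
      rw [← hB', Finset.mem_insert]
      have : b ∉ (L.map Prod.snd).toFinset := by simpa using h₂.1
      by_cases h : e = b
      · subst h; simp only [this, ne_eq, not_true, false_and]
      · simp [h]
    have hab : a ≠ b := fun h => hb.2 (h ▸ ha.1)
    have i₁ := ih (B := insert b (B.erase a)) (B' := B') h₁.2 h₂.2
      (by
        ext e
        rw [hBe]
        simp only [Finset.mem_sdiff, Finset.mem_insert, Finset.mem_erase]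
        grind)
      (by
        ext e
        rw [hBe']
        simp only [Finset.mem_sdiff, Finset.mem_insert, Finset.mem_erase]
        grind)
    have i₂ := ih (B := B) (B' := insert a (B'.erase b)) h₁.2 h₂.2
      (by
        ext e
        rw [hBe]
        simp only [Finset.mem_sdiff, Finset.mem_insert, Finset.mem_erase]
        grind)
      (by
        ext e
        rw [hBe']
        simp only [Finset.mem_sdiff, Finset.mem_insert, Finset.mem_erase]
        grind)
    rw [mergePairs, QueryAlg.expect, Fin.sum_univ_succ]
    simp only [if_true, Fin.succ_ne_zero, if_false, Finset.sum_const, Finset.card_univ,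
      Fintype.card_fin, nsmul_eq_mul]
    have ht : (0 : ℝ) ≤ t := Nat.cast_nonneg t
    refine le_trans ?_ (div_le_div_of_nonneg_right (add_le_add i₁
      (mul_le_mul_of_nonneg_left i₂ ht)) (by linarith))
    have hba : b ≠ a := hab.symm
    refine mlExt_le_exchange hs (List.nodup_finRange n) hab (List.mem_finRange a)
      (List.mem_finRange b) (fun e => ?_) (fun e => ?_) (s := 1 / T) ht ?_ ?_ ?_ ?_ ?_ ?_ ∅
    · have := hr0 e
      split_ifs <;> positivity
    · rw [div_le_one hT]
      have := hr1 e
      split_ifs <;> linarith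
    · simp [ha, hab]; ring
    · simp [hb]; ring
    · simp [ha]; ring
    · simp [hb, hba]; ring
    · intro e h h'
      simp [h, h']
    · intro e h h'
      simp [h, h']

theorem zip_sort_sdiff {B B' : Finset (Fin n)} (h : B.card = B'.card) :
    (((B \ B').sort (· ≤ ·)).zip ((B' \ B).sort (· ≤ ·))).map Prod.fst =
        (B \ B').sort (· ≤ ·) ∧
      (((B \ B').sort (· ≤ ·)).zip ((B' \ B).sort (· ≤ ·))).map Prod.snd =
        (B' \ B).sort (· ≤ ·) := by
  have hc : (B \ B').card = (B' \ B).card := Finset.card_sdiff_comm h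
  exact ⟨List.map_fst_zip (by simp [hc]), List.map_snd_zip (by simp [hc])⟩

theorem mergeBases_always (t : ℕ) {B B' : Finset (Fin n)} (h : B.card = B'.card) :
    (mergeBases (m := m) t B B').Always O (fun C => C.card = B.card) := by
  obtain ⟨h₁, h₂⟩ := zip_sort_sdiff h
  exact mergePairs_always t (by rw [h₁]; exact Finset.sort_nodup _ _)
    (by rw [h₂]; exact Finset.sort_nodup _ _) (by rw [h₁]; simp) (by rw [h₂]; simp)

theorem swapMerge_always {K : ℕ} (t : ℕ) {C : Finset (Fin n)} (hC : C.card = K)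
    {L : List (Finset (Fin n))} (hL : ∀ B ∈ L, B.card = K) :
    (swapMerge (m := m) t C L).Always O (fun S => S.card = K) := by
  induction L generalizing t C with
  | nil => exact hC
  | cons B L ih =>
    rw [swapMerge, QueryAlg.always_bind]
    refine (mergeBases_always t (hC.trans (hL B List.mem_cons_self).symm)).mono ?_
    intro C' hC'
    exact ih (t + 1) (hC'.trans hC) fun B hB => hL B (List.mem_cons_of_mem _ hB)

theorem swapMerge_expect (hs : IsSubmodular φ) {K : ℕ} (t : ℕ) (ht : 0 < t)
    {C : Finset (Fin n)} (hC : C.card = K)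
    {L : List (Finset (Fin n))} (hL : ∀ B ∈ L, B.card = K) :
    mlExt φ (fun e => (t * (if e ∈ C then 1 else 0) +
        (L.map fun X => if e ∈ X then (1 : ℝ) else 0).sum) / (t + L.length : ℕ))
        (List.finRange n) ∅ ≤ (swapMerge (m := m) t C L).expect O φ := by
  induction L generalizing t C with
  | nil =>
    have ht' : (t : ℝ) ≠ 0 := by exact_mod_cast ht.ne'
    have h := mlExt_indicator (f := φ) C (List.finRange n) ∅
    simp only [Finset.empty_union, List.toFinset_finRange, Finset.inter_univ] at h
    refine le_of_eq (Eq.trans (mlExt_congr (fun e _ => ?_) _) h)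
    simp only [List.map_nil, List.sum_nil, add_zero, List.length_nil]
    rw [mul_div_cancel_left₀ _ ht']
  | cons B L ih =>
    rw [swapMerge, QueryAlg.expect_bind]
    have hCB : C.card = B.card := hC.trans (hL B List.mem_cons_self).symm
    obtain ⟨h₁, h₂⟩ := zip_sort_sdiff hCB
    have key := mergePairs_expect (O := O) hs t (T := (t + (B :: L).length : ℕ))
      (by push_cast [List.length_cons]; positivity) (sum_indicator_nonneg L)
      (fun e => by push_cast [List.length_cons]; linarith [sum_indicator_le_length L e])
      (L := ((C \ B).sort (· ≤ ·)).zip ((B \ C).sort (· ≤ ·)))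
      (by rw [h₁]; exact Finset.sort_nodup _ _) (by rw [h₂]; exact Finset.sort_nodup _ _)
      (B := C) (B' := B) (by rw [h₁]; simp) (by rw [h₂]; simp)
    refine le_trans (le_of_eq (mlExt_congr (fun e _ => ?_) _))
      (key.trans ((mergeBases_always t hCB).expect_le_expect ?_))
    · simp only [List.map_cons, List.sum_cons]; ring
    · intro C' hC'
      have := ih (t + 1) (Nat.succ_pos t) (hC'.trans hC)
        fun B hB => hL B (List.mem_cons_of_mem _ hB)
      refine le_trans (le_of_eq (mlExt_congr (fun e _ => ?_) _)) this
      rw [List.length_cons, show t + (L.length + 1) = t + 1 + L.length by ring]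
      push_cast
      rfl

theorem swapRound_always {K : ℕ} {Xs : List (Finset (Fin n))} (hne : Xs ≠ [])
    (hXs : ∀ X ∈ Xs, X.card = K) :
    (swapRound (m := m) Xs).Always O (fun S => S.card = K) := by
  cases Xs with
  | nil => exact absurd rfl hne
  | cons X L =>
    exact swapMerge_always 1 (hXs X List.mem_cons_self)
      fun B hB => hXs B (List.mem_cons_of_mem _ hB)

theorem mlExt_le_swapRound_expect (hs : IsSubmodular φ) {K : ℕ} {Xs : List (Finset (Fin n))}
    (hne : Xs ≠ []) (hXs : ∀ X ∈ Xs, X.card = K) :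
    mlExt φ (fun e => (Xs.map fun X => if e ∈ X then (1 : ℝ) else 0).sum / Xs.length)
      (List.finRange n) ∅ ≤ (swapRound (m := m) Xs).expect O φ := by
  cases Xs with
  | nil => exact absurd rfl hne
  | cons X L =>
    refine le_trans (le_of_eq (mlExt_congr (fun e _ => ?_) _))
      (swapMerge_expect hs 1 one_pos (hXs X List.mem_cons_self)
        fun B hB => hXs B (List.mem_cons_of_mem _ hB))
    simp only [List.map_cons, List.sum_cons, List.length_cons, Nat.cast_one, one_mul]
    rw [add_comm 1 L.length]

/-- The exponential moments of a monotone submodular function after swap rounding. -/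
theorem swapRound_expect_exp_le (hs : IsSubmodular φ) (hm : Monotone φ) (h0 : φ ∅ = 0)
    (hf : ∀ S e, φ (insert e S) - φ S ≤ 1) {K : ℕ} {Xs : List (Finset (Fin n))}
    (hne : Xs ≠ []) (hXs : ∀ X ∈ Xs, X.card = K) {c : ℝ} (hc : 0 ≤ c) :
    (swapRound (m := m) Xs).expect O (fun S => Real.exp (-c * φ S)) ≤
      Real.exp (-((1 - Real.exp (-c)) *
        ((1 - 1 / Real.exp 1) * ((Xs.map φ).sum / Xs.length)))) := by
  have hlen : (0 : ℝ) < Xs.length := by exact_mod_cast List.length_pos_iff.2 hne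
  have h1 := mlExt_le_swapRound_expect (O := O) (hs.neg_exp hm hc) hne hXs
  have h2 := (swapRound (m := m) Xs).expect_const_mul (O := O) (-1)
    (fun S => Real.exp (-c * φ S))
  simp only [neg_mul, one_mul] at h1 h2
  rw [h2, mlExt_neg] at h1
  set x : Fin n → ℝ := fun e =>
    (Xs.map fun X => if e ∈ X then (1 : ℝ) else 0).sum / Xs.length with hx
  have hx0 : ∀ e, 0 ≤ x e := fun e => div_nonneg (sum_indicator_nonneg Xs e) hlen.le
  have hx1 : ∀ e, x e ≤ 1 := fun e => by
    rw [hx, div_le_one hlen]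
    exact sum_indicator_le_length Xs e
  have h3 := mlExt_exp_le hs hm hf hx0 hx1 c (List.finRange n) ∅
  have h4 := mlExt_avg_ge hs hm h0.ge Xs hne
  simp only [neg_mul] at h3 ⊢
  refine (neg_le_neg_iff.1 h1).trans (h3.trans (Real.exp_le_exp.2 ?_))
  rw [h0]
  have h5 : 0 ≤ 1 - Real.exp (-c) := by
    linarith [Real.exp_le_one_iff.2 (neg_nonpos.2 hc)]
  have := mul_le_mul_of_nonneg_left h4 h5
  linarith

end rounding

/-! ### Stage 1 -/

theorem stageOne_always {n m : ℕ} {f : Fin m → Finset (Fin n) → ℝ} {V : Fin m → ℝ} {ε : ℝ}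
    (hε : 0 < ε) (hV : ∀ i, 0 < V i) (hm : ∀ i, Monotone fun S => min (f i S) (V i))
    (hs : ∀ i, IsSubmodular fun S => min (f i S) (V i)) (L : List (Fin n))
    (S : Finset (Fin n)) (hS : ε ^ 3 * S.card ≤ ∑ i, min (f i S) (V i) / V i) :
    (stageOne V ε L S (fun i => min (f i S) (V i))).Always (valueOracle f) (fun r =>
      (r.2 = fun i => min (f i r.1) (V i)) ∧ S ⊆ r.1 ∧
      ε ^ 3 * r.1.card ≤ ∑ i, min (f i r.1) (V i) / V i ∧
      ∀ e ∈ L, ∀ i, min (f i (insert e r.1)) (V i) - min (f i r.1) (V i) ≤ ε ^ 3 * V i) := by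
  induction L generalizing S with
  | nil => exact ⟨rfl, subset_rfl, hS, by simp⟩
  | cons e L ih =>
    rw [stageOne, QueryAlg.always_bind]
    change QueryAlg.Always _ (if ∃ i, ε ^ 3 * V i ≤ min (f i (insert e S)) (V i) -
      min (f i S) (V i) then stageOne V ε L (insert e S) (fun i => min (f i (insert e S)) (V i))
      else stageOne V ε L S (fun i => min (f i S) (V i))) _
    split_ifs with h
    · obtain ⟨i, hi⟩ := h
      refine (ih (insert e S) ?_).mono ?_
      · have h1 : ((insert e S).card : ℝ) ≤ S.card + 1 := by
          exact_mod_cast Finset.card_insert_le e S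
        have h2 : ε ^ 3 ≤ ∑ j, (min (f j (insert e S)) (V j) / V j - min (f j S) (V j) / V j) := by
          refine le_trans ?_ (Finset.single_le_sum (fun j _ => ?_) (Finset.mem_univ i))
          · rw [← sub_div, le_div_iff₀ (hV i)]
            exact hi
          · exact sub_nonneg.2 (div_le_div_of_nonneg_right
              (hm j (Finset.subset_insert e S)) (hV j).le)
        rw [Finset.sum_sub_distrib] at h2
        have h3 := mul_le_mul_of_nonneg_left h1 (pow_pos hε 3).le
        linarith
      · rintro r ⟨h1, h2, h3, h4⟩
        refine ⟨h1, (Finset.subset_insert e S).trans h2, h3, ?_⟩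
        simp only [List.mem_cons, forall_eq_or_imp]
        refine ⟨fun j => ?_, h4⟩
        rw [Finset.insert_eq_self.2 (h2 (Finset.mem_insert_self e S)), sub_self]
        have := hV j
        positivity
    · refine (ih S hS).mono ?_
      rintro r ⟨h1, h2, h3, h4⟩
      refine ⟨h1, h2, h3, ?_⟩
      simp only [List.mem_cons, forall_eq_or_imp]
      refine ⟨fun j => ?_, h4⟩
      push Not at h
      exact ((hs j).insert_sub_le (hm j) h2 e).trans (h j).le

/-! ### Stage 2 -/

section mwu

variable {n m : ℕ} {O : Finset (Fin n) → Fin m → ℝ} {V y : Fin m → ℝ} {S₁ : Finset (Fin n)}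
  {v : Fin m → Finset (Fin n) → ℝ}

theorem mwuRounds_always
    (hv : ∀ X P, P (fun i => v i X) → (normalizedMarginals V S₁ y X).Always O P)
    (hs : ∀ i, IsSubmodular (v i)) (hm : ∀ i, Monotone (v i)) (h0 : ∀ i, v i ∅ = 0)
    (h1 : ∀ i X, v i X ≤ 1) (hout : ∀ e ∈ S₁, ∀ i X, v i (insert e X) ≤ v i X)
    {k k₁ : ℕ} (hk : 1 ≤ k) (hkn : k ≤ n) (hk₁ : k₁ + S₁.card ≤ k) {η : ℝ} (hη0 : 0 < η)
    (hη1 : η < (1 - 1 / Real.exp 1) / 2) {S : Finset (Fin n)} (hS : S.card ≤ k) (T : ℕ)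
    (lam : Fin m → ℝ) (hl0 : ∀ i, 0 ≤ lam i) (hl1 : ∀ i, lam i * v i S = lam i) :
    (mwuRounds V S₁ y k₁ η T lam).Always O (fun Xs => Xs.length = T ∧
      (∀ X ∈ Xs, X.card = k₁) ∧
      ∀ i, lam i * (Xs.map fun X => 1 - η * (v i X - (1 - 1 / Real.exp 1 - η))).prod ≤
        (∑ j, lam j) *
          (1 - η * ((1 - 1 / Real.exp 1) * (k₁ / k) - η - (1 - 1 / Real.exp 1 - η))) ^ T) := by
  have he := exp_one_bounds
  have hkpos : (0 : ℝ) < k := by exact_mod_cast hk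
  have hβ1 : (k₁ : ℝ) / k ≤ 1 := by
    rw [div_le_one hkpos]; exact_mod_cast (by omega : k₁ ≤ k)
  set α := 1 - 1 / Real.exp 1 - η with hα
  set γ := (1 - 1 / Real.exp 1) * (k₁ / k) - η with hγ
  have hv0 : ∀ i X, 0 ≤ v i X := fun i X => h0 i ▸ hm i (Finset.empty_subset X)
  have hpos : 0 ≤ 1 - η * (γ - α) := by
    have : γ - α ≤ 0 := by
      have := mul_le_mul_of_nonneg_left hβ1 (by linarith : 0 ≤ 1 - 1 / Real.exp 1)
      linarith
    have := mul_nonpos_of_nonneg_of_nonpos hη0.le this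
    linarith
  induction T generalizing lam with
  | zero =>
    refine ⟨rfl, by simp, fun i => ?_⟩
    simpa using Finset.single_le_sum (fun j _ => hl0 j) (Finset.mem_univ i)
  | succ T ih =>
    rw [mwuRounds, QueryAlg.always_bind]
    have hG : ((List.finRange n).filter (fun e => e ∉ S₁)).Nodup :=
      (List.nodup_finRange n).filter _
    have hGl : k₁ ≤ ((List.finRange n).filter (fun e => e ∉ S₁)).length := by
      rw [← List.toFinset_card_of_nodup hG]
      have h2 : ((List.finRange n).filter (fun e => e ∉ S₁)).toFinset = S₁ᶜ := by
        ext e; simp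
      rw [h2, Finset.card_compl, Fintype.card_fin]
      omega
    refine (thresholdGreedy_always (φ := fun X => ∑ i, lam i * v i X) ?_
      (IsSubmodular.sum_mul hs hl0)
      (fun A B h => Finset.sum_le_sum fun i _ => mul_le_mul_of_nonneg_left (hm i h) (hl0 i))
      (by simp [h0]) hG ?_ hk hkn (by omega) hGl hη0 hη1 hS).mono ?_
    · intro X P hP
      rw [QueryAlg.always_bind]
      exact hv X _ hP
    · intro e he X
      have heS : e ∈ S₁ := by simpa using he
      exact Finset.sum_le_sum fun i _ => mul_le_mul_of_nonneg_left (hout e heS i X) (hl0 i)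
    · rintro X ⟨hXc, hXg⟩
      rw [QueryAlg.always_bind]
      refine hv X _ ?_
      rw [QueryAlg.always_bind]
      have hfac : ∀ i, 0 ≤ 1 - η * (v i X - α) := fun i => by
        have : v i X - α ≤ 1 := by linarith [h1 i X]
        nlinarith
      refine (ih (fun i => lam i * (1 - η * (v i X - α)))
        (fun i => mul_nonneg (hl0 i) (hfac i)) (fun i => ?_)).mono ?_
      · rw [mul_right_comm, hl1]
      · rintro Xs ⟨hlen, hc, hw⟩
        refine ⟨by simp [hlen], by simpa [hXc] using hc, fun i => ?_⟩
        rw [List.map_cons, List.prod_cons, ← mul_assoc]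
        refine (hw i).trans ?_
        rw [pow_succ', ← mul_assoc]
        refine mul_le_mul_of_nonneg_right ?_ (pow_nonneg hpos T)
        simp only [hl1] at hXg
        have hsum : ∑ j, lam j * (1 - η * (v j X - α)) =
            (∑ j, lam j) * (1 + η * α) - η * ∑ j, lam j * v j X := by
          rw [Finset.sum_mul, Finset.mul_sum, ← Finset.sum_sub_distrib]
          exact Finset.sum_congr rfl fun j _ => by ring
        rw [hsum]
        have := mul_le_mul_of_nonneg_left hXg hη0.le
        linarith

theorem neg_sub_sq_half_le_log {η x : ℝ} (hη0 : 0 < η) (hη1 : η < 0.3161) (hx0 : -0.6322 ≤ x)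
    (hx1 : x ≤ 0.685) : 0 < 1 - η * x ∧ -(η * x) - η ^ 2 / 2 ≤ Real.log (1 - η * x) := by
  have hx : |x| ≤ 0.685 := abs_le.2 ⟨by linarith, hx1⟩
  have hy : |η * x| ≤ 0.22 := by
    rw [abs_mul, abs_of_pos hη0]
    nlinarith [abs_nonneg x]
  have hx2 : x ^ 2 ≤ 0.47 := by nlinarith
  refine ⟨by linarith [le_abs_self (η * x)], ?_⟩
  have h := Real.abs_log_sub_add_sum_range_le (x := η * x) (by linarith) 2
  simp only [Finset.sum_range_succ, Finset.sum_range_zero] at h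
  norm_num at h
  have h1 := (abs_le.1 h).1
  have h2 : |η * x| ^ 3 / (1 - |η * x|) ≤ (η * x) ^ 2 * 0.29 := by
    rw [div_le_iff₀ (by linarith), ← sq_abs (η * x)]
    nlinarith [sq_nonneg (|η * x|)]
  have h3 : (η * x) ^ 2 ≤ 0.47 * η ^ 2 := by
    rw [mul_pow]
    nlinarith [sq_nonneg η]
  rw [abs_mul] at h2
  nlinarith [sq_nonneg η]

theorem exp_sum_le_list_prod {η α : ℝ} {w : List ℝ}
    (hw : ∀ x ∈ w, 0 < 1 - η * (x - α) ∧
      -(η * (x - α)) - η ^ 2 / 2 ≤ Real.log (1 - η * (x - α))) :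
    Real.exp (-η * w.sum + w.length * (η * α - η ^ 2 / 2)) ≤
      (w.map fun x => 1 - η * (x - α)).prod := by
  induction w with
  | nil => simp
  | cons x w ih =>
    have ih := ih fun x hx => hw x (List.mem_cons_of_mem _ hx)
    obtain ⟨h1, h2⟩ := hw x List.mem_cons_self
    rw [Real.le_log_iff_exp_le h1] at h2
    rw [List.map_cons, List.prod_cons]
    refine le_trans (le_of_eq ?_) (mul_le_mul h2 ih (Real.exp_pos _).le h1.le)
    rw [← Real.exp_add, List.sum_cons, List.length_cons]
    push_cast
    ring_nf

theorem average_ge_of_prod_le (hm : 0 < m) {η α γ : ℝ} (hη0 : 0 < η) (hγ : γ ≤ α) {T : ℕ}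
    {w : List ℝ} (hlen : w.length = T) (hT : 2 * Real.log m / η ^ 2 ≤ T)
    (hw : ∀ x ∈ w, 0 < 1 - η * (x - α) ∧
      -(η * (x - α)) - η ^ 2 / 2 ≤ Real.log (1 - η * (x - α)))
    (hprod : 1 / (m : ℝ) * (w.map fun x => 1 - η * (x - α)).prod ≤
      (1 - η * (γ - α)) ^ T) : T * (γ - η) ≤ w.sum := by
  have hm0 : (0 : ℝ) < m := by exact_mod_cast hm
  have h1 := mul_le_mul_of_nonneg_left (exp_sum_le_list_prod hw) (one_div_pos.2 hm0).le
  have h2 : (1 - η * (γ - α)) ^ T ≤ Real.exp (T * (-(η * (γ - α)))) := by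
    rw [Real.exp_nat_mul]
    refine pow_le_pow_left₀ ?_ (by linarith [Real.add_one_le_exp (-(η * (γ - α)))]) _
    nlinarith
  have h3 : 1 / (m : ℝ) = Real.exp (-Real.log m) := by
    rw [Real.exp_neg, Real.exp_log hm0, one_div]
  have h4 := h1.trans (hprod.trans h2)
  rw [h3, ← Real.exp_add, Real.exp_le_exp, hlen] at h4
  rw [div_le_iff₀ (by positivity)] at hT
  have h5 : 0 ≤ η * (w.sum - T * (γ - η)) := by linarith
  linarith [nonneg_of_mul_nonneg_right h5 hη0]

/-- Stage 2: for every objective that has not reached its target, the average of the normalized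
marginals of the sets found is large. -/
theorem stageTwo_always
    (hv : ∀ X P, P (fun i => v i X) → (normalizedMarginals V S₁ y X).Always O P)
    (hs : ∀ i, IsSubmodular (v i)) (hmono : ∀ i, Monotone (v i)) (h0 : ∀ i, v i ∅ = 0)
    (h1 : ∀ i X, v i X ≤ 1) (hout : ∀ e ∈ S₁, ∀ i X, v i (insert e X) ≤ v i X)
    {k k₁ : ℕ} (hm : 2 ≤ m) (hk : 1 ≤ k) (hkn : k ≤ n) (hk₁ : k₁ + S₁.card ≤ k) {δ : ℝ}
    (hδ0 : 0 < δ) (hδ1 : δ < 1 - 1 / Real.exp 1) {S : Finset (Fin n)} (hS : S.card ≤ k)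
    (hvS : ∀ i, y i < V i → v i S = 1) :
    (stageTwo V S₁ y k₁ (δ / 2)).Always O (fun Xs => Xs ≠ [] ∧ (∀ X ∈ Xs, X.card = k₁) ∧
      ∀ i, y i < V i →
        (1 - 1 / Real.exp 1) * (k₁ / k) - δ ≤ (Xs.map (v i)).sum / Xs.length) := by
  have he := exp_one_bounds
  have hm0 : (0 : ℝ) < m := by exact_mod_cast (by omega : 0 < m)
  have hlog : 0 < Real.log m := Real.log_pos (by exact_mod_cast (by omega : 1 < m))
  have hv0 : ∀ i X, 0 ≤ v i X := fun i X => h0 i ▸ hmono i (Finset.empty_subset X)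
  have hkpos : (0 : ℝ) < k := by exact_mod_cast hk
  have hβ1 : (k₁ : ℝ) / k ≤ 1 := by
    rw [div_le_one hkpos]; exact_mod_cast (by omega : k₁ ≤ k)
  rw [stageTwo]
  set T := ⌈2 * Real.log m / (δ / 2) ^ 2⌉₊ with hT
  have hT0 : 0 < T := Nat.ceil_pos.2 (by positivity)
  refine (mwuRounds_always hv hs hmono h0 h1 hout hk hkn hk₁ (by linarith) (by linarith) hS T
    (fun i => if y i < V i then 1 / (m : ℝ) else 0) (fun i => ?_) (fun i => ?_)).mono ?_
  · split_ifs <;> positivity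
  · split_ifs with h
    · rw [hvS i h, mul_one]
    · rw [zero_mul]
  · rintro Xs ⟨hlen, hc, hw⟩
    refine ⟨by rintro rfl; simp at hlen; omega, hc, fun i hi => ?_⟩
    have hwi := hw i
    rw [if_pos hi] at hwi
    have hsum : ∑ j, (if y j < V j then 1 / (m : ℝ) else 0) ≤ 1 := by
      calc ∑ j, (if y j < V j then 1 / (m : ℝ) else 0) ≤ ∑ _j : Fin m, 1 / (m : ℝ) :=
            Finset.sum_le_sum fun j _ => by split_ifs <;> [exact le_rfl; positivity]
        _ = 1 := by
            rw [Finset.sum_const, Finset.card_univ, Fintype.card_fin, nsmul_eq_mul]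
            field_simp
    have hγα : (1 - 1 / Real.exp 1) * (k₁ / k) - δ / 2 ≤ 1 - 1 / Real.exp 1 - δ / 2 := by
      have := mul_le_mul_of_nonneg_left hβ1 (by linarith : 0 ≤ 1 - 1 / Real.exp 1)
      linarith
    have hpow := pow_nonneg (by nlinarith : 0 ≤ 1 - δ / 2 *
      ((1 - 1 / Real.exp 1) * (k₁ / k) - δ / 2 - (1 - 1 / Real.exp 1 - δ / 2))) T
    have h2 := hwi.trans (mul_le_of_le_one_left hpow hsum)
    have h3 := average_ge_of_prod_le (m := m) (η := δ / 2) (T := T) (w := Xs.map (v i)) (by omega) (by linarith) hγα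
      (by simpa using hlen) (Nat.le_ceil _) (fun x hx => by
        obtain ⟨X, -, rfl⟩ := List.mem_map.1 hx
        have := hv0 i X
        have := h1 i X
        exact neg_sub_sq_half_le_log (by linarith) (by linarith) (by linarith) (by linarith))
      (by simpa [Function.comp_def] using h2)
    have hTpos : (0 : ℝ) < T := by exact_mod_cast hT0
    rw [hlen, le_div_iff₀ hTpos]
    linarith

end mwu

/-! ### The approximation guarantee -/

theorem exp_neg_le_quadratic {x : ℝ} (hx : 0 ≤ x) : Real.exp (-x) ≤ 1 - x + x ^ 2 / 2 := by
  have h1 := Real.quadratic_le_exp_of_nonneg hx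
  have h2 : 0 < 1 - x + x ^ 2 / 2 := by nlinarith [sq_nonneg (x - 1)]
  rw [Real.exp_neg, inv_le_comm₀ (Real.exp_pos x) h2]
  refine le_trans ?_ h1
  rw [inv_le_iff_one_le_mul₀ h2]
  nlinarith [sq_nonneg (x ^ 2)]

theorem deviation_exponent_le {ε s A c δ ρ P : ℝ} (hε0 : 0 < ε) (hs0 : 0 ≤ s)
    (hs1 : s ≤ 1) (hA0 : 0 ≤ A) (hA1 : A ≤ 1) (hc : c ≤ 1) (hδ : 0 ≤ δ) (hcδ : 0 ≤ c * δ)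
    (hρ : ρ = (1 - ε) * A - δ) (hρ0 : 0 ≤ ρ) (hP : s * (A - c * δ) ≤ P) :
    ε * ((ρ - (1 - s)) / ε ^ 3) - (1 - Real.exp (-ε)) * (P / ε ^ 3) ≤ -(A / (2 * ε)) := by
  have hcδ' : c * δ ≤ δ := mul_le_of_le_one_left hδ hc
  have hμ0 : 0 ≤ A - c * δ := by nlinarith
  have hsμ : s * (A - c * δ) ≤ A := by nlinarith
  have hsμ0 : 0 ≤ s * (A - c * δ) := mul_nonneg hs0 hμ0
  have hκ0 : 0 ≤ 1 - Real.exp (-ε) := by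
    linarith [Real.exp_le_one_iff.2 (neg_nonpos.2 hε0.le)]
  have hκ : ε - ε ^ 2 / 2 ≤ 1 - Real.exp (-ε) := by linarith [exp_neg_le_quadratic hε0.le]
  have h1 : (ε - ε ^ 2 / 2) * (s * (A - c * δ)) ≤ (1 - Real.exp (-ε)) * P :=
    mul_le_mul hκ hP hsμ0 hκ0
  have h2 : ρ - (1 - s) - s * (A - c * δ) ≤ -(ε * A) := by
    have : (1 - s) * (A - c * δ) ≤ (1 - s) * 1 :=
      mul_le_mul_of_nonneg_left (by linarith) (by linarith)
    linarith
  have h3 := mul_le_mul_of_nonneg_left h2 hε0.le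
  have h4 := mul_le_mul_of_nonneg_left hsμ (by positivity : 0 ≤ ε ^ 2 / 2)
  have h5 : ε * ((ρ - (1 - s)) / ε ^ 3) - (1 - Real.exp (-ε)) * (P / ε ^ 3) =
      (ε * (ρ - (1 - s)) - (1 - Real.exp (-ε)) * P) / ε ^ 3 := by ring
  have h6 : -(A / (2 * ε)) = -(ε ^ 2 * A / 2) / ε ^ 3 := by field_simp
  rw [h5, h6]
  exact div_le_div_of_nonneg_right (by linarith) (by positivity)

section guarantee

variable {n m k : ℕ} {f : Fin m → Finset (Fin n) → ℝ} {V : Fin m → ℝ}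

theorem IsFeasibleInstance.monotone_min (h : IsFeasibleInstance f V k) (i : Fin m) :
    Monotone fun S => min (f i S) (V i) :=
  fun _ _ hAB => min_le_min_right _ (h.monotone i hAB)

theorem IsFeasibleInstance.submodular_min (h : IsFeasibleInstance f V k) (i : Fin m) :
    IsSubmodular fun S => min (f i S) (V i) :=
  (h.submodular i).min_const (h.monotone i) (V i)

/-- The probability that swap rounding fails for one objective. -/
theorem swapRound_failure_le (h : IsFeasibleInstance f V k) {S₁ : Finset (Fin n)} {ε : ℝ}
    (hε0 : 0 < ε) (i : Fin m)
    (hmarg : ∀ e, min (f i (insert e S₁)) (V i) - min (f i S₁) (V i) ≤ ε ^ 3 * V i)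
    (hlive : min (f i S₁) (V i) < V i) {K : ℕ} {Xs : List (Finset (Fin n))} (hne : Xs ≠ [])
    (hXs : ∀ X ∈ Xs, X.card = K) {A δ ρ : ℝ} (hA0 : 0 ≤ A) (hA1 : A ≤ 1) (hδ : 0 ≤ δ)
    (hρ : ρ = (1 - ε) * A - δ)
    (havg : A - (1 - 1 / Real.exp 1) * δ ≤ (1 - 1 / Real.exp 1) *
      ((Xs.map fun X => (min (f i (S₁ ∪ X)) (V i) - min (f i S₁) (V i)) /
        (V i - min (f i S₁) (V i))).sum / Xs.length)) :
    (swapRound (m := m) Xs).expect (valueOracle f)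
      (fun S => if ρ * V i ≤ f i (S₁ ∪ S) then 0 else 1) ≤ Real.exp (-(A / (2 * ε))) := by
  have he := exp_one_bounds
  have hV := h.target_pos i
  rcases lt_or_ge ρ 0 with hneg | hρ0
  · have h1 : ∀ S, ρ * V i ≤ f i (S₁ ∪ S) := fun S =>
      (mul_nonpos_of_nonpos_of_nonneg hneg.le hV.le).trans (h.nonneg i _)
    simp only [h1, if_true, QueryAlg.expect_const]
    positivity
  set y := min (f i S₁) (V i) with hy
  have hy0 : 0 ≤ y := le_min (h.nonneg i S₁) hV.le
  have hd : 0 < ε ^ 3 * V i := by positivity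
  set φ : Finset (Fin n) → ℝ := fun X => (min (f i (S₁ ∪ X)) (V i) - y) / (ε ^ 3 * V i) with hφ
  have hφs : IsSubmodular φ := ((h.submodular_min i).comp_union S₁).sub_div y hd.le
  have hφm : Monotone φ := fun A B hAB => div_le_div_of_nonneg_right
    (sub_le_sub_right (h.monotone_min i (Finset.union_subset_union_right hAB)) _) hd.le
  have hφ0 : φ ∅ = 0 := by simp [hφ, hy]
  have hφ1 : ∀ S e, φ (insert e S) - φ S ≤ 1 := by
    intro S e
    rw [hφ, ← sub_div, div_le_one hd, Finset.union_insert]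
    have := (h.submodular_min i).insert_sub_le (h.monotone_min i)
      (Finset.subset_union_left (s₁ := S₁) (s₂ := S)) e
    linarith [hmarg e]
  have hE := swapRound_expect_exp_le (m := m) (O := valueOracle f) hφs hφm hφ0 hφ1 hne hXs
    hε0.le
  set z := (ρ * V i - y) / (ε ^ 3 * V i) with hz
  have hle : (swapRound (m := m) Xs).expect (valueOracle f)
      (fun S => if ρ * V i ≤ f i (S₁ ∪ S) then 0 else 1) ≤
      (swapRound (m := m) Xs).expect (valueOracle f)
        (fun S => Real.exp (ε * z) * Real.exp (-ε * φ S)) := by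
    refine (QueryAlg.always_of_forall _ (P := fun _ => True) fun _ => trivial).expect_le_expect
      fun S _ => ?_
    split_ifs with hS
    · positivity
    · rw [← Real.exp_add]
      refine Real.one_le_exp ?_
      have : φ S ≤ z := div_le_div_of_nonneg_right
        (sub_le_sub_right ((min_le_left _ _).trans (not_le.1 hS).le) _) hd.le
      nlinarith
  rw [QueryAlg.expect_const_mul] at hle
  refine hle.trans ((mul_le_mul_of_nonneg_left hE (Real.exp_pos _).le).trans ?_)
  rw [← Real.exp_add]
  refine Real.exp_le_exp.2 ?_
  set s := (V i - y) / V i with hs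
  have hs0 : 0 ≤ s := div_nonneg (by linarith) hV.le
  have hs1 : s ≤ 1 := by rw [hs, div_le_one hV]; linarith
  set a := (Xs.map fun X => (min (f i (S₁ ∪ X)) (V i) - y) / (V i - y)).sum / Xs.length with ha
  have h1 : z = (ρ - (1 - s)) / ε ^ 3 := by
    rw [hz, hs]; field_simp; ring
  have h2 : (Xs.map φ).sum / Xs.length = s / ε ^ 3 * a := by
    have hVy : V i - y ≠ 0 := by linarith
    rw [ha, mul_div_assoc', ← List.sum_map_mul_left]
    congr 3
    funext X
    rw [hφ, hs]
    field_simp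
  have h3 := deviation_exponent_le (P := s * ((1 - 1 / Real.exp 1) * a)) hε0 hs0 hs1 hA0 hA1
    (by linarith : 1 - 1 / Real.exp 1 ≤ 1) hδ (mul_nonneg (by linarith) hδ) hρ hρ0
    (mul_le_mul_of_nonneg_left havg hs0)
  rw [h2, h1]
  refine le_trans (le_of_eq ?_) h3
  ring

theorem mwuAlgorithm_expect_ge (h : IsFeasibleInstance f V k) (hm : 2 ≤ m) (hk : 1 ≤ k)
    (hkn : k ≤ n) {δ : ℝ} (hδ0 : 0 < δ) (hδ1 : δ < 1 - 1 / Real.exp 1) {ε : ℝ} (hε0 : 0 < ε)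
    (hmk : (m : ℝ) / (k * ε ^ 3) ≤ 1) {A ρ : ℝ}
    (hA : A = (1 - 1 / Real.exp 1) ^ 2 * (1 - m / (k * ε ^ 3)))
    (hρ : ρ = (1 - ε) * A - δ) :
    1 - m * Real.exp (-(A / (2 * ε))) ≤ (mwuAlgorithm n m k V ε δ).expect (valueOracle f)
      ({S | IsApproxSolution f V k ρ S}.indicator 1) := by
  have he := exp_one_bounds
  have hkpos : (0 : ℝ) < k := by exact_mod_cast hk
  have hε3 : 0 < ε ^ 3 := by positivity
  have hA0 : 0 ≤ A := by
    rw [hA]; exact mul_nonneg (sq_nonneg _) (by linarith)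
  have hA1 : A ≤ 1 := by
    have h1 : 0 ≤ (m : ℝ) / (k * ε ^ 3) := by positivity
    rw [hA]
    exact mul_le_one₀ (by nlinarith) (by linarith) (by linarith)
  have hρ1 : ρ ≤ 1 := by nlinarith
  obtain ⟨S, hSk, hSV⟩ := h.feasible
  rw [mwuAlgorithm, QueryAlg.expect_bind]
  change _ ≤ QueryAlg.expect _ (stageOne V ε (List.finRange n) ∅
    (fun i => min (f i ∅) (V i)) >>= _) _
  rw [QueryAlg.expect_bind]
  refine (stageOne_always hε0 h.target_pos h.monotone_min h.submodular_min (List.finRange n) ∅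
    ?_).le_expect ?_
  · simp only [Finset.card_empty, Nat.cast_zero, mul_zero]
    exact Finset.sum_nonneg fun i _ =>
      div_nonneg (le_min (h.nonneg i ∅) (h.target_pos i).le) (h.target_pos i).le
  rintro ⟨S₁, y⟩ ⟨hy, -, hcard, hmarg⟩
  dsimp only at hy hcard hmarg ⊢
  subst hy
  have hS₁ : (S₁.card : ℝ) ≤ m / ε ^ 3 := by
    rw [le_div_iff₀ hε3, mul_comm]
    refine hcard.trans ?_
    calc ∑ i, min (f i S₁) (V i) / V i ≤ ∑ _i : Fin m, (1 : ℝ) :=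
          Finset.sum_le_sum fun i _ => (div_le_one (h.target_pos i)).2 (min_le_right _ _)
      _ = m := by simp
  have hmk' : (m : ℝ) / (k * ε ^ 3) = m / ε ^ 3 / k := by rw [div_div, mul_comm]
  have hS₁k : S₁.card ≤ k := by
    rw [hmk', div_le_one hkpos] at hmk
    exact_mod_cast hS₁.trans hmk
  have hβ : 1 - (m : ℝ) / (k * ε ^ 3) ≤ ((k - S₁.card : ℕ) : ℝ) / k := by
    rw [Nat.cast_sub hS₁k, sub_div, div_self hkpos.ne', hmk']
    linarith [div_le_div_of_nonneg_right hS₁ hkpos.le]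
  set k₁ := k - S₁.card with hk₁
  rw [QueryAlg.expect_bind]
  have hgap : ∀ i, 0 ≤ V i - min (f i S₁) (V i) := fun i => sub_nonneg.2 (min_le_right _ _)
  refine (stageTwo_always (O := valueOracle f) (V := V) (S₁ := S₁)
    (y := fun i => min (f i S₁) (V i)) (v := fun i X => (min (f i (S₁ ∪ X)) (V i) - min (f i S₁) (V i)) /
    (V i - min (f i S₁) (V i))) (fun X P hP => hP)
    (fun i => ((h.submodular_min i).comp_union S₁).sub_div _ (hgap i))
    (fun i A B hAB => div_le_div_of_nonneg_right
      (sub_le_sub_right (h.monotone_min i (Finset.union_subset_union_right hAB)) _) (hgap i))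
    (fun i => by simp)
    (fun i X => div_le_one_of_le₀ (sub_le_sub_right (min_le_right _ _) _) (hgap i))
    (fun e he i X => by
      rw [Finset.union_insert, ← Finset.insert_union, Finset.insert_eq_self.2 he])
    hm hk hkn (by omega) hδ0 hδ1 hSk (fun i hi => ?_)).le_expect ?_
  · have h1 : V i ≤ f i (S₁ ∪ S) := (hSV i).trans (h.monotone i Finset.subset_union_right)
    rw [min_eq_right h1]
    exact div_self (by linarith)
  rintro Xs ⟨hne, hXs, havg⟩
  rw [QueryAlg.expect_bind]
  simp only [QueryAlg.expect_pure]
  set live : Finset (Fin m) := Finset.univ.filter fun i => min (f i S₁) (V i) < V i with hlive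
  have hfail : ∑ i ∈ live, (swapRound (m := m) Xs).expect (valueOracle f)
      (fun S => if ρ * V i ≤ f i (S₁ ∪ S) then 0 else 1) ≤ m * Real.exp (-(A / (2 * ε))) := by
    have h1 : (live.card : ℝ) ≤ m := by
      exact_mod_cast (Finset.card_le_univ live).trans (by simp)
    refine le_trans (Finset.sum_le_card_nsmul live _ (Real.exp (-(A / (2 * ε)))) fun i hi => ?_) ?_
    · have hi : min (f i S₁) (V i) < V i := by simpa [hlive] using hi
      refine swapRound_failure_le h hε0 i (fun e => hmarg e (List.mem_finRange e) i) hi hne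
        hXs hA0 hA1 hδ0.le hρ ?_
      have h2 := mul_le_mul_of_nonneg_left (havg i hi)
        (by linarith : 0 ≤ 1 - 1 / Real.exp 1)
      refine le_trans ?_ h2
      have h3 := mul_le_mul_of_nonneg_left hβ (sq_nonneg (1 - 1 / Real.exp 1))
      rw [hA]
      linarith
    · rw [nsmul_eq_mul]
      exact mul_le_mul_of_nonneg_right h1 (Real.exp_pos _).le
  have hind : (swapRound (m := m) Xs).expect (valueOracle f) (fun S => 1 + -1 * ∑ i ∈ live,
      (if ρ * V i ≤ f i (S₁ ∪ S) then 0 else 1)) ≤ (swapRound (m := m) Xs).expect (valueOracle f)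
      (fun S => ({S | IsApproxSolution f V k ρ S}.indicator 1 (S₁ ∪ S) : ℝ)) := by
    refine (swapRound_always hne hXs).expect_le_expect fun S hS => ?_
    have hnn : ∀ i ∈ live, (0 : ℝ) ≤ if ρ * V i ≤ f i (S₁ ∪ S) then 0 else 1 := by
      intro i _; split_ifs <;> norm_num
    by_cases hall : ∀ i ∈ live, ρ * V i ≤ f i (S₁ ∪ S)
    · have hmem : S₁ ∪ S ∈ {S | IsApproxSolution f V k ρ S} := by
        refine ⟨(Finset.card_union_le _ _).trans (by omega), fun i => ?_⟩
        by_cases hi : i ∈ live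
        · exact hall i hi
        · have h1 : V i ≤ f i S₁ := by
            simp only [hlive, Finset.mem_filter, Finset.mem_univ, true_and, not_lt] at hi
            exact hi.trans (min_le_left _ _)
          exact (mul_le_of_le_one_left (h.target_pos i).le hρ1).trans
            (h1.trans (h.monotone i Finset.subset_union_left))
      rw [Set.indicator_of_mem hmem]
      have := Finset.sum_nonneg hnn
      simp only [Pi.one_apply]
      linarith
    · push Not at hall
      obtain ⟨i, hi, hlt⟩ := hall
      have h1 := Finset.single_le_sum hnn hi
      rw [if_neg (not_le.2 hlt)] at h1
      have h2 : (0 : ℝ) ≤ {S | IsApproxSolution f V k ρ S}.indicator 1 (S₁ ∪ S) :=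
        Set.indicator_nonneg (fun _ _ => zero_le_one) _
      linarith
  rw [QueryAlg.expect_add, QueryAlg.expect_const, QueryAlg.expect_const_mul,
    QueryAlg.expect_sum] at hind
  linarith

end guarantee

theorem epsParam_pos {m k : ℕ} (hm : 2 ≤ m) (hk : 1 ≤ k) : 0 < epsParam m k := by
  have hlog : 0 < Real.log m := Real.log_pos (by exact_mod_cast (by omega : 1 < m))
  have hm0 : (0 : ℝ) < m := by exact_mod_cast (by omega : 0 < m)
  have hk0 : (0 : ℝ) < k := by exact_mod_cast hk
  exact lt_min (by positivity) (by positivity)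

theorem epsParam_mul_log_le {m k : ℕ} (hm : 2 ≤ m) : epsParam m k * (8 * Real.log m) ≤ 1 := by
  have hlog : 0 < Real.log m := Real.log_pos (by exact_mod_cast (by omega : 1 < m))
  rw [← le_div_iff₀ (by positivity)]
  exact min_le_left _ _

theorem log_two_le_log {m : ℕ} (hm : 2 ≤ m) : 0.69 < Real.log 2 ∧ Real.log 2 ≤ Real.log m :=
  ⟨by linarith [Real.log_two_gt_d9], Real.log_le_log (by norm_num) (by exact_mod_cast hm)⟩

theorem mul_exp_neg_le {m : ℕ} (hm : 2 ≤ m) {ε A a : ℝ} (hε0 : 0 < ε)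
    (hε : ε * (8 * Real.log m) ≤ 1) (ha : 1 / 4 ≤ a) (hA : a ≤ A) :
    m * Real.exp (-(A / (2 * ε))) ≤ Real.exp ((1 - 4 * a) * Real.log 2) := by
  have hm0 : (0 : ℝ) < m := by exact_mod_cast (by omega : 0 < m)
  have hlog := log_two_le_log hm
  have h1 : 4 * a * Real.log m ≤ A / (2 * ε) := by
    rw [le_div_iff₀ (by positivity)]
    have := mul_le_mul_of_nonneg_left hε (by linarith : 0 ≤ a)
    linarith
  calc m * Real.exp (-(A / (2 * ε))) = Real.exp (Real.log m + -(A / (2 * ε))) := by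
        rw [Real.exp_add, Real.exp_log hm0]
    _ ≤ _ := Real.exp_le_exp.2 (by nlinarith)

theorem successProb_ge {n m k : ℕ} {f : Fin m → Finset (Fin n) → ℝ} {V : Fin m → ℝ} {δ : ℝ}
    (hm : 2 ≤ m) (hk : 1 ≤ k) (hkn : k ≤ n) (hδ0 : 0 < δ) (hδ1 : δ < 1 - 1 / Real.exp 1)
    (hmk : (m : ℝ) / (k * epsParam m k ^ 3) ≤ 1 / 3) (h : IsFeasibleInstance f V k) :
    ENNReal.ofReal (1 - Real.exp ((1 - 4 * ((1 - 1 / Real.exp 1) ^ 2 * (2 / 3))) * Real.log 2)) ≤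
      successProb k V δ f (guarantee m k - δ) := by
  have he := exp_one_bounds
  rw [successProb, QueryAlg.output_toOuterMeasure]
  refine ENNReal.ofReal_le_ofReal ?_
  refine le_trans ?_ (mwuAlgorithm_expect_ge h hm hk hkn hδ0 hδ1 (epsParam_pos hm hk)
    (by linarith) rfl (by rw [guarantee]; ring))
  exact sub_le_sub_left (mul_exp_neg_le hm (epsParam_pos hm hk) (epsParam_mul_log_le hm)
    (by nlinarith) (mul_le_mul_of_nonneg_left (by linarith) (sq_nonneg _))) 1

/-! ### The asymptotic guarantee -/

theorem div_epsParam_le {m k : ℕ} (hm : 2 ≤ m) (hk : 1 ≤ k) :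
    (m : ℝ) / (k * epsParam m k ^ 3) ≤
      512 * (m * Real.log m ^ 3 / k) + ((m : ℝ) / k) ^ (1 / 4 : ℝ) := by
  have hm0 : (0 : ℝ) < m := by exact_mod_cast (by omega : 0 < m)
  have hk0 : (0 : ℝ) < k := by exact_mod_cast hk
  have hlog : 0 < Real.log m := by linarith [log_two_le_log hm]
  have hq : 0 < ((m : ℝ) / k) ^ (1 / 4 : ℝ) := by positivity
  rcases min_choice (1 / (8 * Real.log m)) (((m : ℝ) / k) ^ (1 / 4 : ℝ)) with h | h
  · rw [epsParam, h]
    have : (m : ℝ) / (k * (1 / (8 * Real.log m)) ^ 3) = 512 * (m * Real.log m ^ 3 / k) := by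
      field_simp; norm_num
    linarith
  · rw [epsParam, h]
    have h4 : (((m : ℝ) / k) ^ (1 / 4 : ℝ)) ^ 4 = (m : ℝ) / k := by
      rw [← Real.rpow_natCast, ← Real.rpow_mul (by positivity)]; norm_num
    have : (m : ℝ) / (k * (((m : ℝ) / k) ^ (1 / 4 : ℝ)) ^ 3) = ((m : ℝ) / k) ^ (1 / 4 : ℝ) := by
      rw [← div_div, div_eq_iff (by positivity), ← pow_succ', h4]
    have h5 : 0 ≤ 512 * (m * Real.log m ^ 3 / k) := by positivity
    linarith

section asymptotic

variable {m : ℕ → ℕ}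

theorem tendsto_mul_log_pow_div
    (ho : (fun k => (m k : ℝ)) =o[atTop] (fun k : ℕ => (k : ℝ) / Real.log k ^ 3)) :
    Tendsto (fun k : ℕ => (m k : ℝ) * Real.log k ^ 3 / k) atTop (𝓝 0) := by
  simpa only [div_div_eq_mul_div] using ho.tendsto_div_nhds_zero

theorem eventually_one_le_log : ∀ᶠ k : ℕ in atTop, 1 ≤ Real.log k ∧ 1 ≤ k :=
  ((Real.tendsto_log_atTop.comp tendsto_natCast_atTop_atTop).eventually_ge_atTop 1).and
    (eventually_ge_atTop 1)

theorem tendsto_div_of_isLittleO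
    (ho : (fun k => (m k : ℝ)) =o[atTop] (fun k : ℕ => (k : ℝ) / Real.log k ^ 3)) :
    Tendsto (fun k : ℕ => (m k : ℝ) / k) atTop (𝓝 0) := by
  refine tendsto_of_tendsto_of_tendsto_of_le_of_le' tendsto_const_nhds
    (tendsto_mul_log_pow_div ho) (Eventually.of_forall fun k => by positivity) ?_
  filter_upwards [eventually_one_le_log] with k hk
  exact div_le_div_of_nonneg_right
    (le_mul_of_one_le_right (Nat.cast_nonneg _) (one_le_pow₀ hk.1)) (Nat.cast_nonneg _)

theorem tendsto_rpow_div_of_isLittleO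
    (ho : (fun k => (m k : ℝ)) =o[atTop] (fun k : ℕ => (k : ℝ) / Real.log k ^ 3)) :
    Tendsto (fun k : ℕ => ((m k : ℝ) / k) ^ (1 / 4 : ℝ)) atTop (𝓝 0) := by
  simpa using (tendsto_div_of_isLittleO ho).rpow_const (p := 1 / 4) (Or.inr (by norm_num))

theorem tendsto_epsParam (hm : ∀ k, 2 ≤ m k)
    (ho : (fun k => (m k : ℝ)) =o[atTop] (fun k : ℕ => (k : ℝ) / Real.log k ^ 3)) :
    Tendsto (fun k => epsParam (m k) k) atTop (𝓝 0) := by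
  refine tendsto_of_tendsto_of_tendsto_of_le_of_le' tendsto_const_nhds
    (tendsto_rpow_div_of_isLittleO ho) ?_ (Eventually.of_forall fun k => min_le_right _ _)
  filter_upwards [eventually_ge_atTop 1] with k hk
  exact (epsParam_pos (hm k) hk).le

theorem tendsto_div_epsParam (hm : ∀ k, 2 ≤ m k)
    (ho : (fun k => (m k : ℝ)) =o[atTop] (fun k : ℕ => (k : ℝ) / Real.log k ^ 3)) :
    Tendsto (fun k : ℕ => (m k : ℝ) / (k * epsParam (m k) k ^ 3)) atTop (𝓝 0) := by
  have hlim := ((tendsto_mul_log_pow_div ho).const_mul 512).add (tendsto_rpow_div_of_isLittleO ho)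
  rw [mul_zero, add_zero] at hlim
  refine tendsto_of_tendsto_of_tendsto_of_le_of_le' tendsto_const_nhds hlim ?_ ?_
  · filter_upwards [eventually_ge_atTop 1] with k hk
    have := epsParam_pos (hm k) hk
    positivity
  · filter_upwards [eventually_ge_atTop 1,
      (tendsto_div_of_isLittleO ho).eventually (gt_mem_nhds one_pos)] with k hk hmk
    have hk0 : (0 : ℝ) < k := by exact_mod_cast hk
    have hm0 : (0 : ℝ) < m k := by exact_mod_cast (by linarith [hm k] : 0 < m k)
    have hlog : 0 < Real.log (m k) := by linarith [log_two_le_log (hm k)]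
    rw [div_lt_one hk0] at hmk
    refine (div_epsParam_le (hm k) hk).trans ?_
    have := Real.log_le_log hm0 hmk.le
    gcongr

theorem tendsto_guarantee (hm : ∀ k, 2 ≤ m k)
    (ho : (fun k => (m k : ℝ)) =o[atTop] (fun k : ℕ => (k : ℝ) / Real.log k ^ 3)) :
    Tendsto (fun k => guarantee (m k) k) atTop (𝓝 ((1 - 1 / Real.exp 1) ^ 2)) := by
  have := (((tendsto_epsParam hm ho).const_sub 1).mul_const ((1 - 1 / Real.exp 1) ^ 2)).mul
    ((tendsto_div_epsParam hm ho).const_sub 1)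
  simpa only [guarantee, sub_zero, one_mul, mul_one] using this

end asymptotic

theorem theorem9 :
    ∃ C p : ℝ, 0 < C ∧ 0 < p ∧
      -- the number of queries
      (∀ (n m k : ℕ) (V : Fin m → ℝ) (δ : ℝ) (f : Fin m → Finset (Fin n) → ℝ),
        2 ≤ m → 1 ≤ k → k ≤ n → 0 < δ → δ < 1 - 1 / Real.exp 1 →
        ((mwuAlgorithm n m k V (epsParam m k) δ).queries (valueOracle f) : ℝ) ≤
          C * (n / δ ^ 3 * Real.log m * Real.log (n / δ))) ∧
      -- the approximation guarantee
      (∀ (n m k : ℕ) (V : Fin m → ℝ) (δ : ℝ) (f : Fin m → Finset (Fin n) → ℝ),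
        2 ≤ m → 1 ≤ k → k ≤ n → 0 < δ → δ < 1 - 1 / Real.exp 1 →
        (m : ℝ) / (k * epsParam m k ^ 3) ≤ 1 / 3 →
        IsFeasibleInstance f V k →
        ENNReal.ofReal p ≤ successProb k V δ f (guarantee m k - δ)) ∧
      -- the asymptotic guarantee
      (∀ m : ℕ → ℕ, (∀ k, 2 ≤ m k) →
        (fun k => (m k : ℝ)) =o[atTop] (fun k : ℕ => (k : ℝ) / Real.log k ^ 3) →
        ∃ r : ℕ → ℝ, Tendsto r atTop (𝓝 ((1 - 1 / Real.exp 1) ^ 2)) ∧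
          ∀ᶠ k in atTop,
            ∀ (n : ℕ) (V : Fin (m k) → ℝ) (δ : ℝ) (f : Fin (m k) → Finset (Fin n) → ℝ),
              k ≤ n → 0 < δ → δ < 1 - 1 / Real.exp 1 →
              IsFeasibleInstance f V k →
              ENNReal.ofReal p ≤ successProb k V δ f (r k - δ)) := by
  refine ⟨200,
    1 - Real.exp ((1 - 4 * ((1 - 1 / Real.exp 1) ^ 2 * (2 / 3))) * Real.log 2),
    by norm_num, ?_, ?_, ?_, ?_⟩
  · have he := exp_one_bounds
    refine sub_pos.2 (Real.exp_lt_one_iff.2 (mul_neg_of_neg_of_pos ?_ (Real.log_pos (by norm_num))))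
    nlinarith
  · intro n m k V δ f hm hk hkn hδ0 hδ1
    refine le_trans ?_ (query_bound hm (hk.trans hkn) hδ0 hδ1)
    exact_mod_cast mwuAlgorithm_queries (O := valueOracle f) k V (epsParam m k) δ
  · intro n m k V δ f hm hk hkn hδ0 hδ1 hmk h
    exact successProb_ge hm hk hkn hδ0 hδ1 hmk h
  · intro m hm ho
    refine ⟨fun k => guarantee (m k) k, tendsto_guarantee hm ho, ?_⟩
    filter_upwards [eventually_ge_atTop 1,
      (tendsto_div_epsParam hm ho).eventually (gt_mem_nhds (by norm_num : (0 : ℝ) < 1 / 3))]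
      with k hk hmk n V δ f hkn hδ0 hδ1 h
    exact successProb_ge (hm k) hk hkn hδ0 hδ1 hmk.le h
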